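/- **Theorem 4.4.** *Feynman diagrams.* A Feynman diagram is a finite connected multigraph $\Gamma=(\mathcal V,\mathcal E)$ with at least one edge and no self-connection (every edge joins two different vertices); $\mathbf F$ is the set of Feynman diagrams up to isomorphism, $\mathcal F$ the set of forests (finite multisets) of elements of $\mathbf F$, and $\langle\cdot\rangle$ denotes the real linear span. For $\Gamma\in\mathbf F$, $S_{\mathbf F}(\Gamma)$ is the order of its automorphism group (pairs of a permutation of the vertices and a permutation of the edges that respect the endpoints). The counting map is $\Phi(\Gamma)=\prod_{v\in\mathcal V}z_{k(v)}$, $k(v)$ being the number of edges attached to $v$; it is extended to forests componentwise. *Multi-indices.* $\mathbf M=\Phi(\mathbf F)$ is the set of monomials $z^\beta=\prod_k z_k^{\beta(k)}$ that come from diagrams, $\mathcal M$ the set of forests (finite multisets) of elements of $\mathbf M$, and $S_{\mathbf M}(z^\beta)=\prod_k\beta(k)!\,(k!)^{\beta(k)}$. For forests, $S(\prod_i x_i^{r_i})=\prod_i r_i!\,S(x_i)^{r_i}$ with distinct $x_i$, where $S$ is $S_{\mathbf F}$ or $S_{\mathbf M}$. *The lift.* $\mathcal P(z^\beta)=\sum_{\Gamma\in\mathbf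 F:\,\Phi(\Gamma)=z^\beta}\frac{S_{\mathbf M}(z^\beta)}{S_{\mathbf F}(\Gamma)}\,\Gamma$, and likewise on forests, $\mathcal P(b)=\sum_{F\in\mathcal F:\,\Phi(F)=b}\frac{S_{\mathbf M}(b)}{S_{\mathbf F}(F)}\,F$ for $b\in\mathcal M$; both are extended linearly. *Degrees.* Fix $\ell\in\mathbb R$ and $d\in\mathbb N$. Put $\deg\Gamma=\ell|\mathcal E|+d(|\mathcal V|-1)$ and $\deg z^\beta=\frac{\ell}{2}\sum_k k\beta(k)+d\left(\sum_k\beta(k)-1\right)$. Let $\mathcal F_-$ and $\mathcal M_-$ be the sets of non-empty forests all of whose elements have non-positive degree. *Coproduct on diagrams.* $\Delta_{\mathbf F}:\langle\mathbf F\rangle\to\langle\mathcal F\rangle\otimes\langle\mathbf F\rangle$ is the linear map with $$\Delta_{\mathbf F}\Gamma=\sum_{\mathcal F_-\ni\bar\Gamma\subsetneq\Gamma}\bar\Gamma\otimes\Gamma/\bar\Gamma .$$ The sum runs over the non-empty proper subsets $\bar{\mathcal E}$ of the edge set; $\bar\Gamma$ is the forest of the connected components of the subgraph formed by $\bar{\mathcal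 E}$ and the vertices incident to it, and is required to lie in $\mathcal F_-$; $\Gamma/\bar\Gamma$ is obtained by contracting each of these components to a single vertex, and is required to lie in $\mathbf F$, i.e. to have no self-connection. *Coproduct on multi-indices.* Let $D=\sum_k z_{k+1}\partial_{z_k}$, let the inner product on polynomials in the variables $z_k$ be given by $\langle z^\alpha,z^\beta\rangle=S_{\mathbf M}(z^\beta)\,\delta_{\alpha,\beta}$, and for $n\ge1$ and $z^{\beta_1},\dots,z^{\beta_n},z^\alpha\in\mathbf M$ put $$\{z^{\beta_1},\dots,z^{\beta_n}\}\star_{\mathbf M}z^\alpha=\sum_{k_1,\dots,k_n\in\mathbb N}\Big(\prod_{i=1}^nD^{k_i}z^{\beta_i}\Big)\Big(\prod_{i=1}^n\partial_{z_{k_i}}\Big)z^\alpha .$$ $\Delta_{\mathbf M}:\langle\mathbf M\rangle\to\langle\mathcal M\rangle\otimes\langle\mathbf M\rangle$ is the linear map dual to $\star_{\mathbf M}$ restricted to $\mathcal M_-$, that is, $$\Delta_{\mathbf M}z^\beta=\sum_{b\in\mathcal M_-}\ \sum_{z^\alpha\in\mathbf M}\frac{\langle b\star_{\mathbf M}z^\alpha,z^\beta\rangle}{S_{\mathbf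 M}(b)\,S_{\mathbf M}(z^\alpha)}\;b\otimes z^\alpha$$ (a finite sum). *Statement.* For every $z^\beta\in\mathbf M$, $$(\mathcal P\otimes\mathcal P)\circ\Delta_{\mathbf M}(z^\beta)=\Delta_{\mathbf F}\circ\mathcal P(z^\beta).$$ -/

import Mathlib

open scoped TensorProduct Nat

noncomputable section

/-! ### Feynman diagrams -/

/-- Two vertices are equivalent if they are joined by a path of edges belonging to `S`. -/
def linked {V E : Type} (ends : E → Sym2 V) (S : Set E) : Setoid V :=
  Relation.EqvGen.setoid fun u v => ∃ e ∈ S, ends e = s(u, v)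

lemma linked_map {V E V' E' : Type} {ends : E → Sym2 V} {ends' : E' → Sym2 V'} {S : Set E}
    {S' : Set E'} (f : V → V') (g : E → E') (h : ∀ e, ends' (g e) = (ends e).map f)
    (hS : ∀ e ∈ S, g e ∈ S') {u v : V} (huv : linked ends S u v) :
    linked ends' S' (f u) (f v) := by
  induction huv with
  | rel u v h1 =>
    obtain ⟨e, he, h2⟩ := h1
    exact Relation.EqvGen.rel _ _ ⟨g e, hS e he, by simp [h, h2]⟩
  | refl u => exact Setoid.refl' _ _
  | symm u v _ ih => exact Setoid.symm' _ ih
  | trans u v w _ _ ih1 ih2 => exact Setoid.trans' _ ih1 ih2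

/-- A (vacuum, undecorated, unoriented) Feynman diagram: a finite connected multigraph with at
least one edge and without self-connections.  Every edge `e` has an unordered pair `ends e` of
endpoints; several edges may have the same endpoints. -/
structure FeynmanDiagram where
  V : Type
  E : Type
  finite_V : Finite V
  finite_E : Finite E
  ends : E → Sym2 V
  nonempty_E : Nonempty E
  loopless : ∀ e, ¬ (ends e).IsDiag
  connected : ∀ u v, linked ends Set.univ u v

namespace FeynmanDiagram

instance (G : FeynmanDiagram) : Finite G.V := G.finite_V
instance (G : FeynmanDiagram) : Finite G.E := G.finite_E
instance (G : FeynmanDiagram) : Fintype G.V := Fintype.ofFinite _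
instance (G : FeynmanDiagram) : Fintype G.E := Fintype.ofFinite _
instance (G : FeynmanDiagram) : Nonempty G.E := G.nonempty_E

/-- An isomorphism: a bijection of the vertices and a bijection of the edges that are
compatible with the endpoints. -/
def Iso (G H : FeynmanDiagram) : Type :=
  {p : (G.V ≃ H.V) × (G.E ≃ H.E) // ∀ e, H.ends (p.2 e) = (G.ends e).map p.1}

namespace Iso

def refl (G : FeynmanDiagram) : Iso G G :=
  ⟨(Equiv.refl _, Equiv.refl _), fun e => by simp⟩

def symm {G H : FeynmanDiagram} (f : Iso G H) : Iso H G :=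
  ⟨(f.1.1.symm, f.1.2.symm), fun e => by
    have h := f.2 (f.1.2.symm e)
    simp only [Equiv.apply_symm_apply] at h
    simp [h, Sym2.map_map]⟩

def trans {G H K : FeynmanDiagram} (f : Iso G H) (g : Iso H K) : Iso G K :=
  ⟨(f.1.1.trans g.1.1, f.1.2.trans g.1.2), fun e => by
    simp [f.2, g.2, Sym2.map_map]⟩

end Iso

/-- Being isomorphic. -/
instance isoSetoid : Setoid FeynmanDiagram where
  r G H := Nonempty (Iso G H)
  iseqv := ⟨fun G => ⟨Iso.refl G⟩, fun ⟨f⟩ => ⟨f.symm⟩, fun ⟨f⟩ ⟨g⟩ => ⟨f.trans g⟩⟩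

/-- The arity of a vertex: the number of edges attached to it. -/
def arity (G : FeynmanDiagram) (v : G.V) : ℕ := Nat.card {e : G.E // v ∈ G.ends e}

/-- The exponent of the monomial `∏ v, z_{k(v)}`, where `k(v)` is the arity of `v`. -/
def count (G : FeynmanDiagram) : ℕ →₀ ℕ := ∑ v : G.V, Finsupp.single (G.arity v) 1

/-- The order of the automorphism group. -/
def sym (G : FeynmanDiagram) : ℕ := Nat.card (Iso G G)

/-- The degree `ℓ |E| + d (|V| - 1)`. -/
def deg (ℓ : ℝ) (d : ℕ) (G : FeynmanDiagram) : ℝ :=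
  ℓ * (Nat.card G.E : ℝ) + (d : ℝ) * ((Nat.card G.V : ℝ) - 1)

lemma Iso.arity_eq {G H : FeynmanDiagram} (f : Iso G H) (v : G.V) :
    H.arity (f.1.1 v) = G.arity v := by
  refine (Nat.card_congr (f.1.2.subtypeEquiv fun e => ?_)).symm
  rw [f.2 e, Sym2.mem_map]
  constructor
  · intro h; exact ⟨v, h, rfl⟩
  · rintro ⟨w, hw, h⟩
    rwa [← f.1.1.injective h]

lemma count_congr {G H : FeynmanDiagram} (h : G ≈ H) : G.count = H.count := by
  obtain ⟨f⟩ := h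
  refine Fintype.sum_equiv f.1.1 _ _ fun v => ?_
  rw [f.arity_eq]

lemma sym_congr {G H : FeynmanDiagram} (h : G ≈ H) : G.sym = H.sym := by
  obtain ⟨f⟩ := h
  refine Nat.card_congr ⟨fun g => (f.symm.trans g).trans f, fun g => (f.trans g).trans f.symm,
    fun g => ?_, fun g => ?_⟩
  · apply Subtype.ext
    apply Prod.ext <;> ext x <;> simp [Iso.trans, Iso.symm]
  · apply Subtype.ext
    apply Prod.ext <;> ext x <;> simp [Iso.trans, Iso.symm]

lemma deg_congr (ℓ : ℝ) (d : ℕ) {G H : FeynmanDiagram} (h : G ≈ H) : G.deg ℓ d = H.deg ℓ d := by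
  obtain ⟨f⟩ := h
  rw [deg, deg, Nat.card_congr f.1.1, Nat.card_congr f.1.2]

/-! ### Subgraphs, extraction and contraction

A subgraph each of whose vertices is incident to one of its edges is given by its edge set `S`. -/

/-- The connected pieces of the subgraph with edge set `S`: the classes of linked vertices that
carry at least one edge of `S`. -/
def Piece (G : FeynmanDiagram) (S : Set G.E) : Type :=
  {c : Quotient (linked G.ends S) // ∃ e ∈ S, ∀ v ∈ G.ends e, Quotient.mk _ v = c}

instance (G : FeynmanDiagram) (S : Set G.E) : Finite (G.Piece S) :=
  inferInstanceAs (Finite {c : Quotient (linked G.ends S) //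
    ∃ e ∈ S, ∀ v ∈ G.ends e, Quotient.mk _ v = c})
instance (G : FeynmanDiagram) (S : Set G.E) : Fintype (G.Piece S) := Fintype.ofFinite _

/-- A connected piece of the subgraph with edge set `S`, as a Feynman diagram. -/
def extract (G : FeynmanDiagram) (S : Set G.E) (c : G.Piece S) : FeynmanDiagram where
  V := {v : G.V // Quotient.mk (linked G.ends S) v = c.1}
  E := {e : G.E // e ∈ S ∧ ∀ v ∈ G.ends e, Quotient.mk (linked G.ends S) v = c.1}
  finite_V := inferInstance
  finite_E := inferInstance
  ends e := (G.ends e.1).attachWith e.2.2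
  nonempty_E := by
    obtain ⟨e, he, h⟩ := c.2
    exact ⟨⟨e, he, h⟩⟩
  loopless := by
    rintro ⟨e, he, h⟩ hd
    apply G.loopless e
    have := Sym2.attachWith_map_subtypeVal (s := G.ends e) h
    rw [← this]
    exact hd.map
  connected := by
    have key : ∀ u v, Relation.EqvGen (fun u v => ∃ e ∈ S, G.ends e = s(u, v)) u v →
        ∀ (hu : Quotient.mk (linked G.ends S) u = c.1)
          (hv : Quotient.mk (linked G.ends S) v = c.1),
        linked (fun e : {e : G.E // e ∈ S ∧ ∀ v ∈ G.ends e,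
            Quotient.mk (linked G.ends S) v = c.1} => (G.ends e.1).attachWith e.2.2)
          Set.univ ⟨u, hu⟩ ⟨v, hv⟩ := by
      intro u v h
      induction h with
      | rel u v h =>
        intro hu hv
        obtain ⟨e, he, h⟩ := h
        refine Relation.EqvGen.rel _ _ ⟨⟨e, he, ?_⟩, Set.mem_univ _, ?_⟩
        · intro w hw
          rw [h, Sym2.mem_iff] at hw
          rcases hw with rfl | rfl <;> assumption
        · apply Sym2.map.injective Subtype.val_injective
          simp [h]
      | refl u => intro hu hv; exact Setoid.refl' _ _
      | symm u v _ ih => intro hu hv; exact Setoid.symm' _ (ih hv hu)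
      | trans u v w huv _ ih1 ih2 =>
        intro hu hw
        have hv : Quotient.mk (linked G.ends S) v = c.1 := by
          rw [← hu]; exact (Quotient.sound huv).symm
        exact Setoid.trans' _ (ih1 hu hv) (ih2 hv hw)
    rintro ⟨u, hu⟩ ⟨v, hv⟩
    exact key u v (Quotient.exact (hu.trans hv.symm)) hu hv

/-- Contracting each connected piece of the proper subgraph with edge set `S` to one vertex gives
a Feynman diagram, that is, no remaining edge becomes a self-connection. -/
def Contractible (G : FeynmanDiagram) (S : Set G.E) : Prop :=
  S ≠ Set.univ ∧ ∀ e ∉ S, ¬ ((G.ends e).map (Quotient.mk (linked G.ends S))).IsDiag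

/-- The diagram obtained by contracting each connected piece of the subgraph with edge set `S` to
one vertex. -/
def contract (G : FeynmanDiagram) (S : Set G.E) (h : G.Contractible S) : FeynmanDiagram where
  V := Quotient (linked G.ends S)
  E := {e : G.E // e ∉ S}
  finite_V := inferInstance
  finite_E := inferInstance
  ends e := (G.ends e.1).map (Quotient.mk (linked G.ends S))
  nonempty_E := by
    obtain ⟨e, he⟩ := (Set.ne_univ_iff_exists_notMem S).1 h.1
    exact ⟨⟨e, he⟩⟩
  loopless e := h.2 e.1 e.2
  connected := by
    have key : ∀ u v, Relation.EqvGen (fun u v => ∃ e ∈ Set.univ, G.ends e = s(u, v)) u v →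
        linked (fun e : {e : G.E // e ∉ S} =>
          (G.ends e.1).map (Quotient.mk (linked G.ends S))) Set.univ
          (Quotient.mk _ u) (Quotient.mk _ v) := by
      intro u v h
      induction h with
      | rel u v h =>
        obtain ⟨e, -, h⟩ := h
        by_cases he : e ∈ S
        · have : Quotient.mk (linked G.ends S) u = Quotient.mk _ v :=
            Quotient.sound (Relation.EqvGen.rel _ _ ⟨e, he, h⟩)
          rw [this]
        · exact Relation.EqvGen.rel _ _ ⟨⟨e, he⟩, Set.mem_univ _, by simp [h]⟩
      | refl u => exact Setoid.refl' _ _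
      | symm u v _ ih => exact Setoid.symm' _ ih
      | trans u v w _ _ ih1 ih2 => exact Setoid.trans' _ ih1 ih2
    intro a b
    induction a using Quotient.inductionOn
    induction b using Quotient.inductionOn
    exact key _ _ (G.connected _ _)

/-- The forest formed by the connected pieces of the subgraph with edge set `S`. -/
def pieces (G : FeynmanDiagram) (S : Set G.E) : Multiset (Quotient isoSetoid) :=
  (Finset.univ : Finset (G.Piece S)).val.map fun c => Quotient.mk _ (G.extract S c)

/-- The subgraph with edge set `S` is non-empty and proper, all its connected pieces have
non-positive degree, and contracting them gives a Feynman diagram. -/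
def Extractable (ℓ : ℝ) (d : ℕ) (G : FeynmanDiagram) (S : Set G.E) : Prop :=
  S.Nonempty ∧ G.Contractible S ∧ ∀ c : G.Piece S, (G.extract S c).deg ℓ d ≤ 0

namespace Iso

variable {G H : FeynmanDiagram} (f : Iso G H) {S : Set G.E} {T : Set H.E}

lemma linked_iff (hS : ∀ e, f.1.2 e ∈ T ↔ e ∈ S) (u v : G.V) :
    linked G.ends S u v ↔ linked H.ends T (f.1.1 u) (f.1.1 v) := by
  constructor
  · exact fun h => linked_map f.1.1 f.1.2 f.2 (fun e he => (hS e).2 he) h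
  · intro h
    have := linked_map (S' := S) f.symm.1.1 f.symm.1.2 f.symm.2
      (fun e he => (hS _).1 (by simpa [Iso.symm] using he)) h
    simpa [Iso.symm] using this

def quotEquiv (hS : ∀ e, f.1.2 e ∈ T ↔ e ∈ S) :
    Quotient (linked G.ends S) ≃ Quotient (linked H.ends T) :=
  Quotient.congr f.1.1 (f.linked_iff hS)

lemma quotEquiv_mk (hS : ∀ e, f.1.2 e ∈ T ↔ e ∈ S) (v : G.V) :
    f.quotEquiv hS (Quotient.mk _ v) = Quotient.mk _ (f.1.1 v) := rfl

lemma mk_eq_iff (hS : ∀ e, f.1.2 e ∈ T ↔ e ∈ S) (v : G.V) (c : Quotient (linked G.ends S)) :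
    Quotient.mk (linked H.ends T) (f.1.1 v) = f.quotEquiv hS c ↔ Quotient.mk _ v = c := by
  rw [← f.quotEquiv_mk hS, (f.quotEquiv hS).apply_eq_iff_eq]

lemma inPiece_iff (hS : ∀ e, f.1.2 e ∈ T ↔ e ∈ S) (e : G.E) (c : Quotient (linked G.ends S)) :
    (f.1.2 e ∈ T ∧ ∀ v ∈ H.ends (f.1.2 e), Quotient.mk (linked H.ends T) v = f.quotEquiv hS c) ↔
      (e ∈ S ∧ ∀ v ∈ G.ends e, Quotient.mk (linked G.ends S) v = c) := by
  rw [hS, f.2]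
  simp only [Sym2.mem_map, forall_exists_index, and_imp, forall_apply_eq_imp_iff₂, f.mk_eq_iff hS]

def pieceEquiv (hS : ∀ e, f.1.2 e ∈ T ↔ e ∈ S) : G.Piece S ≃ H.Piece T :=
  (f.quotEquiv hS).subtypeEquiv fun c => by
    rw [← f.1.2.exists_congr_right]
    simp only [f.inPiece_iff hS]

lemma extract_equiv (hS : ∀ e, f.1.2 e ∈ T ↔ e ∈ S) (c : G.Piece S) :
    G.extract S c ≈ H.extract T (f.pieceEquiv hS c) := by
  refine ⟨⟨(f.1.1.subtypeEquiv fun v => (f.mk_eq_iff hS v c.1).symm,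
    f.1.2.subtypeEquiv fun e => (f.inPiece_iff hS e c.1).symm), ?_⟩⟩
  rintro ⟨e, he⟩
  apply Sym2.map.injective Subtype.val_injective
  have h1 : ((G.extract S c).ends ⟨e, he⟩).map Subtype.val = G.ends e :=
    Sym2.attachWith_map_subtypeVal _
  have h2 : ∀ e', ((H.extract T (f.pieceEquiv hS c)).ends e').map Subtype.val = H.ends e'.1 :=
    fun e' => Sym2.attachWith_map_subtypeVal _
  refine (h2 _).trans ((f.2 e).trans ?_)
  rw [← h1]
  generalize (G.extract S c).ends ⟨e, he⟩ = z
  induction z with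
  | _ a b => rfl

lemma map_mk_eq (hS : ∀ e, f.1.2 e ∈ T ↔ e ∈ S) (e : G.E) :
    (H.ends (f.1.2 e)).map (Quotient.mk (linked H.ends T)) =
      ((G.ends e).map (Quotient.mk (linked G.ends S))).map (f.quotEquiv hS) := by
  rw [f.2, Sym2.map_map, Sym2.map_map]
  rfl

lemma contractible_iff (hS : ∀ e, f.1.2 e ∈ T ↔ e ∈ S) : H.Contractible T ↔ G.Contractible S := by
  unfold Contractible
  refine and_congr ?_ ?_
  · rw [Set.ne_univ_iff_exists_notMem, Set.ne_univ_iff_exists_notMem,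
      ← f.1.2.exists_congr_right]
    simp only [hS]
  · rw [← f.1.2.forall_congr_right]
    simp only [hS, f.map_mk_eq hS, Sym2.isDiag_map (f.quotEquiv hS).injective]

lemma contract_equiv (hS : ∀ e, f.1.2 e ∈ T ↔ e ∈ S) (h : G.Contractible S)
    (h' : H.Contractible T) : G.contract S h ≈ H.contract T h' :=
  ⟨⟨(f.quotEquiv hS, f.1.2.subtypeEquiv fun e => not_congr (hS e).symm),
    fun e => f.map_mk_eq hS e.1⟩⟩

lemma pieces_eq (hS : ∀ e, f.1.2 e ∈ T ↔ e ∈ S) : G.pieces S = H.pieces T := by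
  unfold pieces
  rw [← Finset.map_univ_equiv (f.pieceEquiv hS), Finset.map_val, Multiset.map_map]
  exact Multiset.map_congr rfl fun c _ => Quotient.sound (f.extract_equiv hS c)

lemma extractable_iff (ℓ : ℝ) (d : ℕ) (hS : ∀ e, f.1.2 e ∈ T ↔ e ∈ S) :
    H.Extractable ℓ d T ↔ G.Extractable ℓ d S := by
  unfold Extractable
  refine and_congr ?_ (and_congr (f.contractible_iff hS) ?_)
  · unfold Set.Nonempty
    rw [← f.1.2.exists_congr_right]
    simp only [hS]
  · rw [← (f.pieceEquiv hS).forall_congr_right]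
    simp only [deg_congr ℓ d (f.extract_equiv hS _)]

end Iso

end FeynmanDiagram

/-- Connected Feynman diagrams up to isomorphism. -/
def FD : Type 1 := Quotient FeynmanDiagram.isoSetoid

/-- Forests of Feynman diagrams; the forest product is the sum of multisets. -/
abbrev FDForest : Type 1 := Multiset FD

namespace FD

def count (G : FD) : ℕ →₀ ℕ := Quotient.lift FeynmanDiagram.count (fun _ _ => FeynmanDiagram.count_congr) G

def sym (G : FD) : ℕ := Quotient.lift FeynmanDiagram.sym (fun _ _ => FeynmanDiagram.sym_congr) G

end FD

/-- The reduced extraction-contraction coproduct of a diagram: the sum of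
`(extracted forest) ⊗ (contracted diagram)` over all admissible subgraphs. -/
def FeynmanDiagram.coproduct (ℓ : ℝ) (d : ℕ) (G : FeynmanDiagram) :
    (FDForest →₀ ℝ) ⊗[ℝ] (FD →₀ ℝ) :=
  ∑ᶠ S : {S : Set G.E // G.Extractable ℓ d S},
    Finsupp.single (G.pieces S.1 : FDForest) (1 : ℝ) ⊗ₜ[ℝ]
      Finsupp.single (Quotient.mk _ (G.contract S.1 S.2.2.1) : FD) (1 : ℝ)

lemma FeynmanDiagram.coproduct_congr (ℓ : ℝ) (d : ℕ) {G H : FeynmanDiagram} (h : G ≈ H) :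
    G.coproduct ℓ d = H.coproduct ℓ d := by
  obtain ⟨f⟩ := h
  have hS : ∀ S : Set G.E, ∀ e, f.1.2 e ∈ Equiv.Set.congr f.1.2 S ↔ e ∈ S := fun S e => by
    simp [Equiv.Set.congr]
  refine finsum_eq_of_bijective
    ((Equiv.Set.congr f.1.2).subtypeEquiv fun S => (f.extractable_iff ℓ d (hS S)).symm)
    (Equiv.bijective _) fun S => ?_
  congr 2
  · exact f.pieces_eq (hS S.1)
  · exact Quotient.sound (f.contract_equiv (hS S.1) _ _)

/-- The reduced extraction-contraction coproduct `Δ_F`, extended linearly. -/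
def coproductF (ℓ : ℝ) (d : ℕ) : (FD →₀ ℝ) →ₗ[ℝ] (FDForest →₀ ℝ) ⊗[ℝ] (FD →₀ ℝ) :=
  Finsupp.linearCombination ℝ fun G : FD => Quotient.lift (FeynmanDiagram.coproduct ℓ d)
    (fun _ _ => FeynmanDiagram.coproduct_congr ℓ d) G

/-! ### Multi-indices -/

/-- The multi-indices that can be paired to a connected Feynman diagram: the image of the
counting map. -/
def MI : Type := {β : ℕ →₀ ℕ // ∃ G : FD, G.count = β}

/-- Forests of multi-indices; the forest product is the sum of multisets. -/
abbrev MIForest : Type := Multiset MI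

/-- The counting map. -/
def FD.toMI (G : FD) : MI := ⟨G.count, G, rfl⟩

namespace MI

/-- The degree `(ℓ / 2) ∑ k β(k) + d (|β| - 1)`. -/
def deg (ℓ : ℝ) (d : ℕ) (β : MI) : ℝ :=
  ℓ / 2 * (β.1.sum fun k m => (k : ℝ) * (m : ℝ)) + (d : ℝ) * ((β.1.sum fun _ m => (m : ℝ)) - 1)

/-- The symmetry factor `∏ β(k)! (k!) ^ β(k)`. -/
def sym (β : MI) : ℕ := β.1.prod fun k m => m ! * (k !) ^ m

/-- The monomial `z ^ β`. -/
def mono (β : MI) : MvPolynomial ℕ ℝ := MvPolynomial.monomial β.1 1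

end MI

open Classical in
/-- The symmetry factor `∏ r_i! S(x_i) ^ r_i` of a forest in which the distinct elements `x_i`
occur with multiplicities `r_i`, for a symmetry factor `S` of its elements. -/
def forestSym {X : Type*} (S : X → ℕ) (s : Multiset X) : ℕ :=
  ∏ x ∈ s.toFinset, (s.count x)! * S x ^ s.count x

/-- The derivation `D = ∑ z_{k+1} ∂_{z_k}`. -/
def derivD : Derivation ℝ (MvPolynomial ℕ ℝ) (MvPolynomial ℕ ℝ) :=
  MvPolynomial.mkDerivation ℝ fun k => MvPolynomial.X (k + 1)

/-- The simultaneous insertion of the multi-indices of a list into `z ^ α`: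
`∑ (∏ i, D ^ (k i) z ^ (β i)) * (∏ i, ∂_{z_{k i}}) z ^ α` over all tuples `k`.  Tuples with an entry
outside the support of `α` contribute zero. -/
def insertionList (l : List MI) (α : MI) : MvPolynomial ℕ ℝ :=
  ∑ k ∈ Fintype.piFinset fun _ : Fin l.length => α.1.support,
    (∏ i, derivD^[k i] (l.get i).mono) *
      (List.ofFn fun i => ((MvPolynomial.pderiv (k i)).toLinearMap :
        Module.End ℝ (MvPolynomial ℕ ℝ))).prod α.mono

/-- The simultaneous insertion of a forest; it does not depend on the enumeration. -/
def insertion (b : MIForest) (α : MI) : MvPolynomial ℕ ℝ := insertionList b.toList α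

/-- The pairing `⟨p, z ^ β⟩` for which the monomials are orthogonal and
`⟨z ^ β, z ^ β⟩` is the symmetry factor of `β`. -/
def pairing (p : MvPolynomial ℕ ℝ) (β : MI) : ℝ := (β.sym : ℝ) * p.coeff β.1

/-! ### Finiteness of the sums -/

def wt (β : ℕ →₀ ℕ) : ℕ := β.sum fun k m => m * k

namespace FeynmanDiagram

lemma wt_count (G : FeynmanDiagram) : wt G.count = ∑ v : G.V, G.arity v := by
  unfold wt count
  rw [← Finsupp.sum_finsetSum_index (by simp) (by intros; ring)]
  simp

lemma card_E_le (G : FeynmanDiagram) : Fintype.card G.E ≤ wt G.count := by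
  classical
  rw [wt_count]
  have : ∑ v : G.V, G.arity v = Nat.card (Σ v : G.V, {e : G.E // v ∈ G.ends e}) := by
    rw [Nat.card_sigma]; rfl
  rw [this, ← Nat.card_eq_fintype_card]
  exact Nat.card_le_card_of_injective
    (fun e => (⟨(G.ends e).out.1, e, Sym2.out_fst_mem _⟩ : Σ v : G.V, {e : G.E // v ∈ G.ends e}))
    fun e e' h => by
      simp only [Sigma.mk.injEq] at h
      exact congrArg (fun x : Σ v : G.V, {e : G.E // v ∈ G.ends e} => x.2.1)
        (Sigma.ext h.1 h.2 : (⟨(G.ends e).out.1, e, Sym2.out_fst_mem _⟩ :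
          Σ v : G.V, {e : G.E // v ∈ G.ends e}) = ⟨(G.ends e').out.1, e', Sym2.out_fst_mem _⟩)

lemma card_V (G : FeynmanDiagram) : Fintype.card G.V = G.count.sum fun _ m => m := by
  unfold count
  rw [← Finsupp.sum_finsetSum_index (by simp) (by intros; ring)]
  simp

lemma arity_pos (G : FeynmanDiagram) (v : G.V) : 0 < G.arity v := by
  rw [arity, Nat.card_pos_iff]
  refine ⟨?_, inferInstance⟩
  by_contra h
  rw [nonempty_subtype, not_exists] at h
  have key : ∀ x y, linked G.ends Set.univ x y → (x = v ↔ y = v) := by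
    intro x y hxy
    induction hxy with
    | rel x y hxy =>
      obtain ⟨e, -, he⟩ := hxy
      have := h e
      rw [he, Sym2.mem_iff, not_or] at this
      exact ⟨fun hx => absurd hx.symm this.1, fun hy => absurd hy.symm this.2⟩
    | refl => rfl
    | symm _ _ _ ih => exact ih.symm
    | trans _ _ _ _ _ ih1 ih2 => exact ih1.trans ih2
  obtain ⟨e⟩ := G.nonempty_E
  apply h e
  have := (key v _ (G.connected v (G.ends e).out.1)).1 rfl
  rw [← this]
  exact Sym2.out_fst_mem _

lemma count_zero (G : FeynmanDiagram) : G.count 0 = 0 := by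
  unfold count
  rw [Finsupp.finsetSum_apply]
  exact Finset.sum_eq_zero fun v _ => Finsupp.single_eq_of_ne (G.arity_pos v).ne

lemma wt_count_pos (G : FeynmanDiagram) : 0 < wt G.count :=
  lt_of_lt_of_le Fintype.card_pos G.card_E_le

end FeynmanDiagram

lemma FD.finite_fiber (β : ℕ →₀ ℕ) : {G : FD | G.count = β}.Finite := by
  classical
  let T := Σ (n : Fin ((β.sum fun _ m => m) + 1)) (m : Fin (wt β + 1)),
    {f : Fin m → Sym2 (Fin n) // Nonempty (Fin m) ∧ (∀ e, ¬ (f e).IsDiag) ∧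
      ∀ u v, linked f Set.univ u v}
  let g : T → FD := fun t => Quotient.mk _
    ⟨Fin t.1, Fin t.2.1, inferInstance, inferInstance, t.2.2.1, t.2.2.2.1, t.2.2.2.2.1,
      t.2.2.2.2.2⟩
  refine (Set.finite_range g).subset ?_
  intro G hG
  induction G using Quotient.inductionOn with
  | h G =>
  have hG : G.count = β := hG
  subst hG
  have hn : Fintype.card G.V < (G.count.sum fun _ m => m) + 1 := by
    rw [G.card_V]; exact Nat.lt_succ_self _
  have hm : Fintype.card G.E < wt G.count + 1 := Nat.lt_succ_of_le G.card_E_le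
  let σ := Fintype.equivFin G.V
  let τ := Fintype.equivFin G.E
  let f : Fin (Fintype.card G.E) → Sym2 (Fin (Fintype.card G.V)) :=
    fun e => (G.ends (τ.symm e)).map σ
  have hf : ∀ e, f (τ e) = (G.ends e).map σ := fun e => by simp [f]
  refine ⟨⟨⟨_, hn⟩, ⟨_, hm⟩, f, ⟨τ (Classical.arbitrary _)⟩, fun e => ?_, fun u v => ?_⟩, ?_⟩
  · simpa [f, Sym2.isDiag_map σ.injective] using G.loopless _
  · have := linked_map (S' := Set.univ) σ τ hf (fun _ _ => Set.mem_univ _)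
      (G.connected (σ.symm u) (σ.symm v))
    simpa using this
  · exact (Quotient.sound ⟨⟨(σ, τ), hf⟩⟩ :
      (Quotient.mk _ G : FD) = Quotient.mk _ _).symm

namespace MI

lemma apply_zero (β : MI) : β.1 0 = 0 := by
  obtain ⟨β, G, rfl⟩ := β
  induction G using Quotient.inductionOn with
  | h G => exact G.count_zero

lemma wt_pos (β : MI) : 0 < wt β.1 := by
  obtain ⟨β, G, rfl⟩ := β
  induction G using Quotient.inductionOn with
  | h G => exact G.wt_count_pos

lemma finite_wt_le (W : ℕ) : {β : MI | wt β.1 ≤ W}.Finite := by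
  refine Set.Finite.preimage (s := {β : ℕ →₀ ℕ | β 0 = 0 ∧ wt β ≤ W})
    Subtype.val_injective.injOn ?_ |>.subset fun β hβ => ⟨MI.apply_zero β, hβ⟩
  refine (Set.finite_Icc 0 (∑ k ∈ Finset.range (W + 1), Finsupp.single k W)).subset ?_
  rintro β ⟨h0, hW⟩
  refine ⟨fun _ => Nat.zero_le _, fun k => ?_⟩
  by_cases hk : β k = 0
  · rw [hk]; exact Nat.zero_le _
  have hk0 : k ≠ 0 := by rintro rfl; exact hk h0
  have h1 : β k * k ≤ W := by
    refine le_trans ?_ hW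
    exact Finset.single_le_sum (f := fun k => β k * k) (fun _ _ => Nat.zero_le _)
      (Finsupp.mem_support_iff.2 hk)
  have h2 : k ≤ W := le_trans (Nat.le_mul_of_pos_left k (Nat.pos_of_ne_zero hk)) h1
  have h3 : β k ≤ W := le_trans (Nat.le_mul_of_pos_right _ (Nat.pos_of_ne_zero hk0)) h1
  rw [Finsupp.finsetSum_apply]
  refine h3.trans ?_
  refine le_trans (le_of_eq ?_) (Finset.single_le_sum (f := fun i => Finsupp.single i W k)
    (fun _ _ => Nat.zero_le _) (Finset.mem_range.2 (Nat.lt_succ_of_le h2)))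
  simp

lemma finite_forest_wt_le (W : ℕ) :
    {b : MIForest | (b.map fun β => wt β.1).sum ≤ W}.Finite := by
  classical
  refine (Set.finite_Iic (W • (finite_wt_le W).toFinset.val)).subset ?_
  intro b hb
  rw [Set.mem_Iic, Multiset.le_iff_count]
  intro β
  by_cases hβ : β ∈ b
  · have h1 : wt β.1 ≤ W := le_trans (Multiset.single_le_sum (fun _ _ => Nat.zero_le _) _
      (Multiset.mem_map_of_mem (fun β : MI => wt β.1) hβ)) hb
    have h2 : b.card ≤ W := by
      refine le_trans ?_ hb
      have := Multiset.card_nsmul_le_sum (s := b.map fun β => wt β.1) (a := 1) (by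
        intro x hx
        obtain ⟨β, -, rfl⟩ := Multiset.mem_map.1 hx
        exact β.wt_pos)
      simpa using this
    rw [Multiset.count_nsmul]
    have h3 : Multiset.count β (finite_wt_le W).toFinset.val = 1 :=
      Multiset.count_eq_one_of_mem (Finset.nodup _) (by simpa using h1)
    rw [h3]
    simpa using (Multiset.count_le_card β b).trans h2
  · rw [Multiset.count_eq_zero_of_notMem hβ]; exact Nat.zero_le _

end MI

lemma FD.finite_forest_fiber (b : MIForest) : {F : FDForest | F.map FD.toMI = b}.Finite := by
  classical
  induction b using Multiset.induction_on with
  | empty => exact (Set.finite_singleton 0).subset fun F hF => by simpa using hF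
  | cons β b ih =>
    refine Set.Finite.subset (Set.Finite.image2 (fun G F => G ::ₘ F)
      (FD.finite_fiber β.1) ih) ?_
    intro F hF
    obtain ⟨G, hG, h1, h2⟩ := (Multiset.map_eq_cons FD.toMI F b β).2 hF
    exact ⟨G, congrArg Subtype.val h1, _, h2, Multiset.cons_erase hG⟩

open MvPolynomial in
lemma insertion_homogeneous (b : MIForest) (α : MI) (β : ℕ →₀ ℕ) (h : (insertion b α).coeff β ≠ 0) :
    (b.map fun β => wt β.1).sum + wt α.1 = wt β := by
  let w : ℕ → ℤ := fun k => k
  have hw : ∀ β : ℕ →₀ ℕ, Finsupp.weight w β = (wt β : ℤ) := fun β => by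
    simp [Finsupp.weight_apply, wt, Finsupp.sum, w]
  have hD : ∀ (p : MvPolynomial ℕ ℝ) (n : ℤ), IsWeightedHomogeneous w p n →
      IsWeightedHomogeneous w (derivD p) (n + 1) := by
    intro p n hp
    rw [p.as_sum, map_sum, ← mem_weightedHomogeneousSubmodule]
    refine Submodule.sum_mem _ fun s hs => ?_
    rw [derivD, mkDerivation_monomial]
    refine Submodule.smul_mem _ _ (Submodule.sum_mem _ fun k hk => ?_)
    have hn := hp (mem_support_iff.1 hs)
    rw [mem_weightedHomogeneousSubmodule]
    simp only [smul_eq_mul]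
    have h1 : IsWeightedHomogeneous w (monomial (s - Finsupp.single k 1) (s k : ℝ)) (n - k) := by
      refine isWeightedHomogeneous_monomial _ _ _ ?_
      have : s - Finsupp.single k 1 + Finsupp.single k 1 = s :=
        tsub_add_cancel_of_le (by
          simpa using Nat.one_le_iff_ne_zero.2 (Finsupp.mem_support_iff.1 hk))
      rw [← this, map_add, Finsupp.weight_single] at hn
      simp only [w, one_smul] at hn
      linarith
    have h2 : IsWeightedHomogeneous w (X (k + 1) : MvPolynomial ℕ ℝ) (k + 1 : ℤ) := by
      simpa [w] using isWeightedHomogeneous_X ℝ w (k + 1)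
    have := h1.mul h2
    rwa [show n - (k : ℤ) + (k + 1) = n + 1 by ring] at this
  have hDk : ∀ (k : ℕ) (p : MvPolynomial ℕ ℝ) (n : ℤ), IsWeightedHomogeneous w p n →
      IsWeightedHomogeneous w (derivD^[k] p) (n + k) := by
    intro k
    induction k with
    | zero => intro p n hp; simpa using hp
    | succ k ih =>
      intro p n hp
      rw [Function.iterate_succ_apply]
      have := ih _ _ (hD p n hp)
      rwa [show n + 1 + (k : ℤ) = n + ((k + 1 : ℕ) : ℤ) by push_cast; ring] at this
  have hP : ∀ (l : List ℕ) (p : MvPolynomial ℕ ℝ) (n : ℤ), IsWeightedHomogeneous w p n →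
      IsWeightedHomogeneous w ((l.map fun i => ((pderiv i).toLinearMap :
        Module.End ℝ (MvPolynomial ℕ ℝ))).prod p) (n - (l.sum : ℤ)) := by
    intro l
    induction l with
    | nil => intro p n hp; simpa using hp
    | cons i l ih =>
      intro p n hp
      rw [List.map_cons, List.prod_cons, Module.End.mul_apply]
      refine (ih p n hp).pderiv ?_
      simp only [List.sum_cons, w]
      push_cast
      ring
  have hm : ∀ β : MI, IsWeightedHomogeneous w β.mono (wt β.1) := fun β =>
    isWeightedHomogeneous_monomial _ _ _ (hw _)
  have hs : IsWeightedHomogeneous w (insertion b α)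
      (((b.toList.map fun β => (wt β.1 : ℤ)).sum) + wt α.1) := by
    unfold insertion insertionList
    rw [← mem_weightedHomogeneousSubmodule]
    refine Submodule.sum_mem _ fun k _ => ?_
    rw [mem_weightedHomogeneousSubmodule]
    have h1 := IsWeightedHomogeneous.prod Finset.univ
      (fun i => derivD^[k i] (b.toList.get i).mono) _ (fun i _ => hDk (k i) _ _ (hm _))
    have h2 := hP (List.ofFn k) α.mono _ (hm α)
    rw [List.map_ofFn] at h2
    have := h1.mul h2
    have h0 : (List.ofFn fun i => ((pderiv (k i)).toLinearMap :
        Module.End ℝ (MvPolynomial ℕ ℝ))) =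
        List.ofFn ((fun i => ((pderiv i).toLinearMap : Module.End ℝ (MvPolynomial ℕ ℝ))) ∘ k) := rfl
    rw [h0]
    convert this using 1
    rw [Finset.sum_add_distrib, List.sum_ofFn]
    push_cast
    have h3 : (b.toList.map fun β => (wt β.1 : ℤ)).sum =
        ∑ i, (wt (b.toList.get i).1 : ℤ) := by
      rw [← List.sum_ofFn]
      congr 1
      conv_lhs => rw [← List.ofFn_get b.toList]
      rw [List.map_ofFn]
      rfl
    rw [h3]
    ring
  have := hs h
  rw [hw] at this
  have h4 : (b.map fun β => wt β.1).sum = (b.toList.map fun β => wt β.1).sum := by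
    conv_lhs => rw [← b.coe_toList]
    simp
  rw [h4]
  have h5 : ((b.toList.map fun β => wt β.1).sum : ℤ) = (b.toList.map fun β => (wt β.1 : ℤ)).sum := by
    rw [Nat.cast_list_sum, List.map_map]; rfl
  have := this.trans (by rw [← h5])
  exact_mod_cast this.symm

/-! ### The coproduct of multi-indices and the lift to diagrams -/

/-- The forest is non-empty and consists of multi-indices of non-positive degree. -/
def MIForest.Divergent (ℓ : ℝ) (d : ℕ) (b : MIForest) : Prop :=
  b ≠ 0 ∧ ∀ β ∈ b, MI.deg ℓ d β ≤ 0

open Classical in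
/-- The coefficient of `b ⊗ z ^ α` in `Δ_M z ^ β`, determined by
`⟨b ⊗ z ^ α, Δ_M z ^ β⟩ = ⟨b ⋆ z ^ α, z ^ β⟩` for non-empty forests `b` of multi-indices
of non-positive degree; the other coefficients are zero. -/
def coproductCoeff (ℓ : ℝ) (d : ℕ) (β : MI) (p : MIForest × MI) : ℝ :=
  if MIForest.Divergent ℓ d p.1 then
    pairing (insertion p.1 p.2) β / ((forestSym MI.sym p.1 : ℝ) * (p.2.sym : ℝ))
  else 0

lemma finite_support_coproductCoeff (ℓ : ℝ) (d : ℕ) (β : MI) :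
    (Function.support (coproductCoeff ℓ d β)).Finite := by
  refine ((MI.finite_forest_wt_le (wt β.1)).prod (MI.finite_wt_le (wt β.1))).subset ?_
  rintro ⟨b, α⟩ h
  have h1 : (insertion b α).coeff β.1 ≠ 0 := by
    intro h0
    apply h
    simp [coproductCoeff, pairing, h0]
  have := insertion_homogeneous b α β.1 h1
  simp only [Set.mem_prod, Set.mem_ofPred_eq]
  omega

/-- The reduced extraction-contraction coproduct `Δ_M`, extended linearly. -/
def coproductM (ℓ : ℝ) (d : ℕ) : (MI →₀ ℝ) →ₗ[ℝ] (MIForest →₀ ℝ) ⊗[ℝ] (MI →₀ ℝ) :=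
  Finsupp.linearCombination ℝ fun β : MI =>
    ∑ p ∈ (finite_support_coproductCoeff ℓ d β).toFinset, coproductCoeff ℓ d β p •
      (Finsupp.single p.1 (1 : ℝ) ⊗ₜ[ℝ] Finsupp.single p.2 (1 : ℝ))

/-- The lift of multi-indices: `z ^ β` is sent to `∑ (S(z ^ β) / S(Γ)) Γ` over all diagrams `Γ`
counted by `β`. -/
def liftP : (MI →₀ ℝ) →ₗ[ℝ] (FD →₀ ℝ) :=
  Finsupp.linearCombination ℝ fun β : MI =>
    ∑ G ∈ (FD.finite_fiber β.1).toFinset, Finsupp.single G ((β.sym : ℝ) / (G.sym : ℝ))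

/-- The lift of forests of multi-indices. -/
def liftForestP : (MIForest →₀ ℝ) →ₗ[ℝ] (FDForest →₀ ℝ) :=
  Finsupp.linearCombination ℝ fun b : MIForest =>
    ∑ F ∈ (FD.finite_forest_fiber b).toFinset,
      Finsupp.single F ((forestSym MI.sym b : ℝ) / (forestSym FD.sym F : ℝ))

end

/-!
The identity is a double count. Compare the coefficients of `F ⊗ Q` on both sides, where
`F = ∏ i, K i` is a forest and `Q` a diagram. On the left, the normalisations of `Δ_M` and of the
lift cancel the symmetry factors of the multi-indices, and what remains is
`S(z ^ β) · [z ^ β] (Φ(F) ⋆ Φ(Q)) / (S(F) S(Q))`. On the right stands the sum over the diagrams `G`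
with `Φ(G) = z ^ β` of `S(z ^ β) / S(G)` times the number of subgraphs of `G` whose pieces form `F`
and whose contraction is `Q`.

Since `∂_{z_k}` removes a vertex of arity `k` from a product of variables, and `D ^ k` distributes
`k` new legs over the vertices, `Φ(F) ⋆ Φ(Q)` is the sum of `Φ(graft)` over all ways of inserting
the `K i` into distinct vertices of `Q` and reattaching the edges of `Q` that end there to vertices
of the `K i` (`insertionList_eq_finsum`). So it suffices that, for every diagram `G`,

`#{insertions with result G} · S(G) = S(F) S(Q) · #{subgraphs of G with pieces F, contraction Q}`

(`card_graft_mul_sym_eq`). Both sides count the presentations of `G`: the embeddings of the `K i`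
and of the edges of `Q` into `G` together with a projection of the vertices of `G` to those of `Q`.
A presentation is the same thing as an insertion with an isomorphism from its result to `G`
(`presentationOfGraft`), and also the same thing as a contractible subgraph of `G` with a matching
of its pieces with the `K i` and an isomorphism from `Q` to the contraction
(`presentationOfExtraction`). The matchings number `S(F)`, the isomorphisms `S(G)` and `S(Q)`.

The divergence condition plays no role in the count: the counting map preserves degrees because the
arities of a diagram add up to twice the number of its edges (`deg_toMI`).
-/

noncomputable section

/-! ### Grafting diagrams into the vertices of a diagram -/

namespace FeynmanDiagram

variable {I : Type}

instance (G : FeynmanDiagram) : Nonempty G.V :=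
  ⟨(G.ends (Classical.arbitrary G.E)).out.1⟩

/-- Two distinct vertices at which an edge ends are all its endpoints. -/
lemma ends_eq_of_mem (G : FeynmanDiagram) {e : G.E} {z : Sym2 G.V}
    (h : ∀ v, v ∈ z → v ∈ G.ends e) (hz : ¬ z.IsDiag) : G.ends e = z := by
  induction z with
  | _ u v =>
    exact (Sym2.mem_and_mem_iff (by simpa using hz)).1 ⟨h u (by simp), h v (by simp)⟩

/-- The data for inserting the diagrams `K i` simultaneously into the diagram `Q`: the `K i` replace
distinct vertices `ι i` of `Q`, and every edge of `Q` that ends at `ι i` is reattached to a vertex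
of `K i`. -/
abbrev Insertion (K : I → FeynmanDiagram) (Q : FeynmanDiagram) : Type :=
  Σ ι : I ↪ Q.V, ∀ i, {e : Q.E // ι i ∈ Q.ends e} → (K i).V

namespace Insertion

variable {K : I → FeynmanDiagram} {Q : FeynmanDiagram} (d : Insertion K Q)

/-- The vertices of the diagram obtained by an insertion. -/
abbrev Vert : Type := {v : Q.V // v ∉ Set.range d.1} ⊕ Σ i, (K i).V

/-- The edges of the diagram obtained by an insertion. -/
abbrev Edge (_ : Insertion K Q) : Type := Q.E ⊕ Σ i, (K i).E

/-- The vertex of `Q` to which a vertex of the new diagram is contracted. -/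
def proj : d.Vert → Q.V := Sum.elim Subtype.val fun x => d.1 x.1

open Classical in
/-- The vertex of the new diagram to which the end `v` of the edge `e` of `Q` is attached. -/
def attach (e : Q.E) (v : Q.V) (hv : v ∈ Q.ends e) : d.Vert :=
  if h : v ∈ Set.range d.1 then
    Sum.inr ⟨h.choose, d.2 h.choose ⟨e, by rwa [h.choose_spec]⟩⟩
  else Sum.inl ⟨v, h⟩

lemma attach_apply (e : Q.E) (i : I) (h : d.1 i ∈ Q.ends e) :
    d.attach e (d.1 i) h = Sum.inr ⟨i, d.2 i ⟨e, h⟩⟩ := by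
  have h' : d.1 i ∈ Set.range d.1 := ⟨i, rfl⟩
  rw [attach, dif_pos h']
  have key : ∀ j (hj : d.1 j ∈ Q.ends e), j = i →
      (Sum.inr ⟨j, d.2 j ⟨e, hj⟩⟩ : d.Vert) = Sum.inr ⟨i, d.2 i ⟨e, h⟩⟩ := by
    rintro j hj rfl
    rfl
  exact key _ _ (d.1.injective h'.choose_spec)

lemma attach_of_notMem (e : Q.E) (v : Q.V) (h : v ∈ Q.ends e) (hv : v ∉ Set.range d.1) :
    d.attach e v h = Sum.inl ⟨v, hv⟩ := by
  rw [attach, dif_neg hv]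

@[simp] lemma proj_attach (e : Q.E) (v : Q.V) (h : v ∈ Q.ends e) : d.proj (d.attach e v h) = v := by
  by_cases hv : v ∈ Set.range d.1
  · obtain ⟨i, rfl⟩ := hv
    rw [attach_apply]
    rfl
  · rw [attach_of_notMem d e v h hv]
    rfl

lemma proj_surjective : Function.Surjective d.proj := by
  intro v
  by_cases hv : v ∈ Set.range d.1
  · obtain ⟨i, rfl⟩ := hv
    exact ⟨Sum.inr ⟨i, Classical.arbitrary _⟩, rfl⟩
  · exact ⟨Sum.inl ⟨v, hv⟩, rfl⟩

/-- The endpoints of the edges of the new diagram. -/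
def graftEnds : d.Edge → Sym2 d.Vert :=
  Sum.elim (fun e => (Q.ends e).pmap (d.attach e) fun _ h => h)
    fun x => ((K x.1).ends x.2).map fun u => Sum.inr ⟨x.1, u⟩

lemma graftEnds_inl_map_proj (e : Q.E) : (d.graftEnds (Sum.inl e)).map d.proj = Q.ends e := by
  have : ∀ z : Sym2 Q.V, ∀ h : ∀ v ∈ z, v ∈ Q.ends e, (z.pmap (d.attach e) h).map d.proj = z := by
    intro z h
    induction z with
    | _ u v => simp [Sym2.pmap_pair]
  exact this _ _

lemma inl_mem_graftEnds_inl {e : Q.E} {v : {v : Q.V // v ∉ Set.range d.1}} :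
    Sum.inl v ∈ d.graftEnds (Sum.inl e) ↔ v.1 ∈ Q.ends e := by
  constructor
  · intro h
    rw [← d.graftEnds_inl_map_proj]
    exact Sym2.mem_map.2 ⟨_, h, rfl⟩
  · intro h
    exact (Sym2.mem_pmap_iff _ _ _ _).2 ⟨v.1, h, (d.attach_of_notMem e v.1 h v.2).symm⟩

lemma inr_mem_graftEnds_inl {e : Q.E} {i : I} {u : (K i).V} :
    Sum.inr ⟨i, u⟩ ∈ d.graftEnds (Sum.inl e) ↔ ∃ h : d.1 i ∈ Q.ends e, d.2 i ⟨e, h⟩ = u := by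
  constructor
  · intro h
    obtain ⟨v, hv, h⟩ := (Sym2.mem_pmap_iff _ _ _ _).1 h
    have h1 : d.1 i = v := by
      rw [← d.proj_attach e v hv, ← h]; rfl
    subst h1
    rw [attach_apply] at h
    simp only [Sum.inr.injEq, Sigma.mk.injEq, heq_eq_eq, true_and] at h
    exact ⟨hv, h.symm⟩
  · rintro ⟨h, rfl⟩
    exact (Sym2.mem_pmap_iff _ _ _ _).2 ⟨d.1 i, h, (d.attach_apply e i h).symm⟩

lemma inl_notMem_graftEnds_inr {x : Σ i, (K i).E} {v : {v : Q.V // v ∉ Set.range d.1}} :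
    Sum.inl v ∉ d.graftEnds (Sum.inr x) := by
  intro h
  obtain ⟨u, -, h⟩ := Sym2.mem_map.1 h
  simp at h

lemma inr_mem_graftEnds_inr {i j : I} {e : (K j).E} {u : (K i).V} :
    Sum.inr ⟨i, u⟩ ∈ d.graftEnds (Sum.inr ⟨j, e⟩) ↔
      ∃ w ∈ (K j).ends e, (⟨j, w⟩ : Σ i, (K i).V) = ⟨i, u⟩ := by
  refine Sym2.mem_map.trans ?_
  simp

variable [Finite I]

/-- The diagram obtained by an insertion. -/
def graft : FeynmanDiagram where
  V := d.Vert
  E := d.Edge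
  finite_V := inferInstance
  finite_E := inferInstance
  ends := d.graftEnds
  nonempty_E := ⟨Sum.inl (Classical.arbitrary _)⟩
  loopless := by
    rintro (e | ⟨i, e⟩) h
    · apply Q.loopless e
      rw [← d.graftEnds_inl_map_proj]
      exact h.map
    · apply (K i).loopless e
      refine (Sym2.isDiag_map ?_).1 h
      intro u v huv
      simpa using huv
  connected := by
    -- Vertices with the same projection are linked inside one `K i`; edges of `Q` link the rest.
    have same : ∀ w w', d.proj w = d.proj w' → linked d.graftEnds Set.univ w w' := by
      have inr : ∀ i (u u' : (K i).V),
          linked d.graftEnds Set.univ (Sum.inr ⟨i, u⟩) (Sum.inr ⟨i, u'⟩) := fun i u u' =>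
        linked_map (S := Set.univ) (ends := (K i).ends) (fun u => (Sum.inr ⟨i, u⟩ : d.Vert))
          (fun e => Sum.inr ⟨i, e⟩) (fun _ => rfl) (fun _ _ => Set.mem_univ _)
          ((K i).connected u u')
      rintro (v | ⟨i, u⟩) (v' | ⟨i', u'⟩) h
      · rw [Subtype.ext h]
      · exact absurd ⟨i', h.symm⟩ v.2
      · exact absurd ⟨i, h⟩ v'.2
      · obtain rfl := d.1.injective h
        exact inr i u u'
    have key : ∀ v v', linked Q.ends Set.univ v v' →
        ∀ w w', d.proj w = v → d.proj w' = v' → linked d.graftEnds Set.univ w w' := by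
      intro v v' h
      induction h with
      | rel v v' h =>
        rintro w w' rfl rfl
        obtain ⟨e, -, h⟩ := h
        have h1 : d.proj w ∈ Q.ends e := by rw [h]; simp
        have h2 : d.proj w' ∈ Q.ends e := by rw [h]; simp
        refine Setoid.trans' _ (same w (d.attach e _ h1) (by simp)) (Setoid.trans' _ ?_
          (same (d.attach e _ h2) w' (by simp)))
        refine Relation.EqvGen.rel _ _ ⟨Sum.inl e, Set.mem_univ _, ?_⟩
        have : ∀ z : Sym2 Q.V, ∀ (hz : ∀ v ∈ z, v ∈ Q.ends e), z = s(d.proj w, d.proj w') →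
            z.pmap (d.attach e) hz = s(d.attach e _ h1, d.attach e _ h2) := by
          rintro z hz rfl
          rfl
        exact this _ _ h
      | refl v => rintro w w' h rfl; exact same w w' h
      | symm v v' _ ih => exact fun w w' h h' => Setoid.symm' _ (ih w' w h' h)
      | trans v v' v'' _ _ ih1 ih2 =>
        intro w w'' h h''
        obtain ⟨w', h'⟩ := d.proj_surjective v'
        exact Setoid.trans' _ (ih1 w w' h h') (ih2 w' w'' h' h'')
    exact fun w w' => key _ _ (Q.connected _ _) w w' rfl rfl

lemma arity_graft_inl (v : {v : Q.V // v ∉ Set.range d.1}) :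
    d.graft.arity (Sum.inl v) = Q.arity v.1 := by
  refine (Nat.card_congr (Equiv.ofBijective
    (fun e : {e : Q.E // v.1 ∈ Q.ends e} =>
      (⟨Sum.inl e.1, d.inl_mem_graftEnds_inl.2 e.2⟩ :
        {e : d.graft.E // Sum.inl v ∈ d.graft.ends e})) ⟨?_, ?_⟩)).symm
  · rintro ⟨e, he⟩ ⟨e', he'⟩ h
    exact Subtype.ext (Sum.inl.inj (congrArg Subtype.val h))
  · rintro ⟨e | e, he⟩
    · exact ⟨⟨e, d.inl_mem_graftEnds_inl.1 he⟩, rfl⟩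
    · exact absurd he d.inl_notMem_graftEnds_inr

lemma arity_graft_inr (i : I) (u : (K i).V) :
    d.graft.arity (Sum.inr ⟨i, u⟩) = (K i).arity u + Nat.card {e // d.2 i e = u} := by
  rw [add_comm]
  unfold arity
  rw [← Nat.card_sum]
  refine (Nat.card_congr (Equiv.ofBijective
    (Sum.elim (fun e : {e // d.2 i e = u} =>
      (⟨Sum.inl e.1.1, d.inr_mem_graftEnds_inl.2 ⟨e.1.2, e.2⟩⟩ :
        {e : d.graft.E // Sum.inr ⟨i, u⟩ ∈ d.graft.ends e}))
      (fun e : {e : (K i).E // u ∈ (K i).ends e} =>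
        ⟨Sum.inr ⟨i, e.1⟩, d.inr_mem_graftEnds_inr.2 ⟨u, e.2, rfl⟩⟩)) ⟨?_, ?_⟩)).symm
  · rintro (⟨⟨e, he⟩, h1⟩ | ⟨e, he⟩) (⟨⟨e', he'⟩, h2⟩ | ⟨e', he'⟩) h <;>
      have h := congrArg Subtype.val h
    · obtain rfl := Sum.inl.inj h
      rfl
    · exact absurd h Sum.inl_ne_inr
    · exact absurd h Sum.inr_ne_inl
    · have h := Sum.inr.inj h
      simp only [Sigma.mk.injEq, heq_eq_eq, true_and] at h
      subst h
      rfl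
  · rintro ⟨e | ⟨j, e⟩, he⟩
    · obtain ⟨h, h'⟩ := d.inr_mem_graftEnds_inl.1 he
      exact ⟨Sum.inl ⟨⟨e, h⟩, h'⟩, rfl⟩
    · obtain ⟨w, hw, h⟩ := d.inr_mem_graftEnds_inr.1 he
      obtain ⟨rfl, h⟩ := Sigma.mk.inj h
      obtain rfl := eq_of_heq h
      exact ⟨Sum.inr ⟨e, hw⟩, rfl⟩

end Insertion

end FeynmanDiagram

/-! ### Presentations of a diagram by a forest and a contracted diagram -/

namespace FeynmanDiagram

variable {I : Type}

/-- A way of presenting `G` as the result of inserting the diagrams `K i` into the diagram `Q`: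
embeddings `a i`, `y i` of the vertices and edges of `K i` into those of `G`, an embedding `x` of
the edges of `Q`, and a projection `p` to the vertices of `Q` whose fibre over `ι i` is `K i` and whose
other fibres are single vertices. -/
@[ext]
structure Presentation (K : I → FeynmanDiagram) (Q G : FeynmanDiagram) where
  a : ∀ i, (K i).V → G.V
  y : ∀ i, (K i).E → G.E
  p : G.V → Q.V
  x : Q.E → G.E
  ι : I → Q.V
  ι_inj : Function.Injective ι
  p_a : ∀ i u, p (a i u) = ι i
  a_inj : ∀ i, Function.Injective (a i)
  exists_a : ∀ i w, p w = ι i → ∃ u, a i u = w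
  p_inj : ∀ w w', p w = p w' → p w ∉ Set.range ι → w = w'
  p_surj : Function.Surjective p
  edges_bij : Function.Bijective (Sum.elim x fun z : Σ i, (K i).E => y z.1 z.2)
  ends_y : ∀ i e, G.ends (y i e) = ((K i).ends e).map (a i)
  ends_x : ∀ e, (G.ends (x e)).map p = Q.ends e

variable {K : I → FeynmanDiagram} {Q G : FeynmanDiagram}

namespace Presentation

variable (P : Presentation K Q G)

lemma exists_mem_ends_x {e : Q.E} {v : Q.V} (h : v ∈ Q.ends e) :
    ∃ w ∈ G.ends (P.x e), P.p w = v := by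
  rwa [← P.ends_x, Sym2.mem_map] at h

/-- The two endpoints of an edge that comes from `Q` are told apart by their projections. -/
lemma eq_of_mem_ends_x {e : Q.E} {w w' : G.V} (h : w ∈ G.ends (P.x e)) (h' : w' ∈ G.ends (P.x e))
    (hp : P.p w = P.p w') : w = w' := by
  by_contra hne
  apply Q.loopless e
  rw [← P.ends_x, (Sym2.mem_and_mem_iff hne).1 ⟨h, h'⟩]
  simpa using hp

lemma x_inj : Function.Injective P.x := fun e e' h => by
  simpa using P.edges_bij.1 (a₁ := Sum.inl e) (a₂ := Sum.inl e') h

lemma y_inj (i : I) : Function.Injective (P.y i) := fun e e' h => by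
  simpa using P.edges_bij.1 (a₁ := Sum.inr ⟨i, e⟩) (a₂ := Sum.inr ⟨i, e'⟩) h

lemma x_ne_y (e : Q.E) (i : I) (e' : (K i).E) : P.x e ≠ P.y i e' := fun h => by
  simpa using P.edges_bij.1 (a₁ := Sum.inl e) (a₂ := Sum.inr ⟨i, e'⟩) h

lemma exists_edge (e : G.E) : (∃ e', P.x e' = e) ∨ ∃ i e', P.y i e' = e := by
  obtain ⟨e' | ⟨i, e'⟩, h⟩ := P.edges_bij.2 e
  · exact Or.inl ⟨e', h⟩
  · exact Or.inr ⟨i, e', h⟩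

end Presentation

/-! ### Presentations and graftings -/

variable [Finite I]

/-- The presentation given by compatible bijections from the vertices and edges of the result of an
insertion. -/
def presentationOfInsertion (d : Insertion K Q) (f : d.Vert ≃ G.V) (g : d.Edge ≃ G.E)
    (hfg : ∀ e, G.ends (g e) = (d.graftEnds e).map f) : Presentation K Q G where
  a i u := f (Sum.inr ⟨i, u⟩)
  y i e := g (Sum.inr ⟨i, e⟩)
  p w := d.proj (f.symm w)
  x e := g (Sum.inl e)
  ι := d.1
  ι_inj := d.1.injective
  p_a i u := by
    rw [Equiv.symm_apply_apply]; rfl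
  a_inj i u u' h := by
    simpa using h
  exists_a i w h := by
    obtain ⟨w, rfl⟩ := f.surjective w
    rw [Equiv.symm_apply_apply] at h
    obtain v | ⟨j, u⟩ := w
    · exact absurd ⟨i, h.symm⟩ v.2
    · obtain rfl := d.1.injective h
      exact ⟨u, rfl⟩
  p_inj w w' h h' := by
    obtain ⟨w, rfl⟩ := f.surjective w
    obtain ⟨w', rfl⟩ := f.surjective w'
    rw [Equiv.symm_apply_apply] at h h'
    rw [Equiv.symm_apply_apply] at h
    obtain v | ⟨i, u⟩ := w
    · obtain v' | ⟨j, u'⟩ := w'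
      · rw [Subtype.ext h]
      · exact absurd ⟨j, h.symm⟩ h'
    · exact absurd ⟨i, rfl⟩ h'
  p_surj := d.proj_surjective.comp f.symm.surjective
  edges_bij := by
    convert g.bijective using 1
    funext e
    obtain e | e := e <;> rfl
  ends_y i e := by
    rw [hfg, Insertion.graftEnds, Sum.elim_inr, Sym2.map_map]
    rfl
  ends_x e := by
    rw [hfg, Sym2.map_map, ← d.graftEnds_inl_map_proj]
    refine congrArg (fun f => Sym2.map f _) ?_
    funext w
    exact congrArg _ (f.symm_apply_apply w)

/-- The presentation given by an isomorphism from the result of an insertion. -/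
def presentationOfGraft (z : Σ d : Insertion K Q, Iso d.graft G) : Presentation K Q G :=
  presentationOfInsertion z.1 z.2.1.1 z.2.1.2 z.2.2

/-- An insertion and an isomorphism can be read off from the presentation: the reattached end of an
edge `x e` is its only endpoint with the given projection. -/
lemma presentationOfGraft_injective :
    Function.Injective (presentationOfGraft (K := K) (Q := Q) (G := G)) := by
  -- Stated for bare equivalences, so that the heterogeneous equalities are eliminated one by one.
  have key : ∀ (d d' : Insertion K Q) (f : d.Vert ≃ G.V) (f' : d'.Vert ≃ G.V) (g : d.Edge ≃ G.E)
      (g' : d'.Edge ≃ G.E) (h : ∀ e, G.ends (g e) = (d.graftEnds e).map f)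
      (h' : ∀ e, G.ends (g' e) = (d'.graftEnds e).map f'),
      presentationOfInsertion d f g h = presentationOfInsertion d' f' g' h' →
      d = d' ∧ HEq f f' ∧ HEq g g' := by
    rintro ⟨ι, r⟩ ⟨ι', r'⟩ f f' g g' h h' hP
    obtain rfl : ι = ι' := DFunLike.ext' (congrArg Presentation.ι hP)
    have ha : ∀ i u, f (Sum.inr ⟨i, u⟩) = f' (Sum.inr ⟨i, u⟩) := fun i u =>
      congrFun (congrFun (congrArg Presentation.a hP) i) u
    have hy : ∀ i e, g (Sum.inr ⟨i, e⟩) = g' (Sum.inr ⟨i, e⟩) := fun i e =>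
      congrFun (congrFun (congrArg Presentation.y hP) i) e
    have hx : ∀ e, g (Sum.inl e) = g' (Sum.inl e) := fun e =>
      congrFun (congrArg Presentation.x hP) e
    have hp : ∀ w, Insertion.proj ⟨ι, r⟩ (f.symm w) = Insertion.proj ⟨ι, r'⟩ (f'.symm w) :=
      fun w => congrFun (congrArg Presentation.p hP) w
    have hr : r = r' := by
      funext i
      funext ⟨e, he⟩
      set P := presentationOfInsertion ⟨ι, r⟩ f g h with hP'
      apply P.a_inj i
      have h1 : P.a i (r i ⟨e, he⟩) ∈ G.ends (P.x e) := by
        change f _ ∈ G.ends (g _)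
        rw [h]
        exact Sym2.mem_map.2 ⟨_, (Insertion.inr_mem_graftEnds_inl ⟨ι, r⟩).2 ⟨he, rfl⟩, rfl⟩
      have h2 : P.a i (r' i ⟨e, he⟩) ∈ G.ends (P.x e) := by
        rw [hP]
        change f' _ ∈ G.ends (g' _)
        rw [h']
        exact Sym2.mem_map.2 ⟨_, (Insertion.inr_mem_graftEnds_inl ⟨ι, r'⟩).2 ⟨he, rfl⟩, rfl⟩
      exact P.eq_of_mem_ends_x h1 h2 (by rw [P.p_a, P.p_a])
    subst hr
    refine ⟨rfl, heq_of_eq (Equiv.ext ?_), heq_of_eq (Equiv.ext ?_)⟩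
    · rintro (v | ⟨i, u⟩)
      · have hv := hp (f (Sum.inl v))
        rw [Equiv.symm_apply_apply] at hv
        rw [← Equiv.symm_apply_eq]
        generalize f'.symm (f (Sum.inl v)) = w at hv
        obtain v' | ⟨j, u'⟩ := w
        · exact congrArg Sum.inl (Subtype.ext hv.symm)
        · exact absurd ⟨j, hv.symm⟩ v.2
      · exact ha i u
    · rintro (e | ⟨i, e⟩)
      · exact hx e
      · exact hy i e
  rintro ⟨d, ⟨f, g⟩, h⟩ ⟨d', ⟨f', g'⟩, h'⟩ hP
  obtain ⟨rfl, hf, hg⟩ := key d d' f f' g g' h h' hP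
  obtain rfl := eq_of_heq hf
  obtain rfl := eq_of_heq hg
  rfl

/-- Every presentation comes from an insertion: an edge of `Q` that ends at `ι i` is reattached to
the vertex of `K i` at which the corresponding edge of `G` ends. -/
lemma presentationOfGraft_surjective :
    Function.Surjective (presentationOfGraft (K := K) (Q := Q) (G := G)) := by
  intro P
  have hr : ∀ i (e : {e : Q.E // P.ι i ∈ Q.ends e}), ∃ u, P.a i u ∈ G.ends (P.x e.1) := by
    rintro i ⟨e, he⟩
    obtain ⟨w, hw, h⟩ := P.exists_mem_ends_x he
    obtain ⟨u, rfl⟩ := P.exists_a i w h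
    exact ⟨u, hw⟩
  choose r hr using hr
  let d : Insertion K Q := ⟨⟨P.ι, P.ι_inj⟩, r⟩
  let s : Q.V → G.V := Function.surjInv P.p_surj
  have hs : ∀ v, P.p (s v) = v := Function.surjInv_eq P.p_surj
  let fV : d.Vert → G.V := Sum.elim (fun v => s v.1) fun z => P.a z.1 z.2
  have hpf : ∀ w, P.p (fV w) = d.proj w := by
    rintro (v | ⟨i, u⟩)
    · exact hs v.1
    · exact P.p_a i u
  have hfV : Function.Bijective fV := by
    constructor
    · intro w w' h
      have hp : d.proj w = d.proj w' := by rw [← hpf, h, hpf]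
      obtain v | ⟨i, u⟩ := w <;> obtain v' | ⟨i', u'⟩ := w'
      · rw [Subtype.ext hp]
      · exact absurd ⟨i', hp.symm⟩ v.2
      · exact absurd ⟨i, hp⟩ v'.2
      · obtain rfl : i = i' := P.ι_inj hp
        obtain rfl : u = u' := P.a_inj i h
        rfl
    · intro w
      by_cases hw : P.p w ∈ Set.range P.ι
      · obtain ⟨i, hi⟩ := hw
        obtain ⟨u, hu⟩ := P.exists_a i w hi.symm
        exact ⟨Sum.inr ⟨i, u⟩, hu⟩
      · exact ⟨Sum.inl ⟨P.p w, hw⟩, (P.p_inj _ _ (hs _).symm hw).symm⟩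
  have hends : ∀ e, G.ends (Sum.elim P.x (fun z : Σ i, (K i).E => P.y z.1 z.2) e) =
      (d.graftEnds e).map fV := by
    rintro (e | ⟨i, e⟩)
    · refine G.ends_eq_of_mem ?_ ?_
      · intro w' hw'
        obtain ⟨w, hw, rfl⟩ := Sym2.mem_map.1 hw'
        obtain v | ⟨i, u⟩ := w
        · have hv := d.inl_mem_graftEnds_inl.1 hw
          obtain ⟨w, hw1, h⟩ := P.exists_mem_ends_x hv
          have : w = fV (Sum.inl v) := P.p_inj _ _ (h.trans (hs _).symm) (by rw [h]; exact v.2)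
          rwa [← this]
        · obtain ⟨h, rfl⟩ := d.inr_mem_graftEnds_inl.1 hw
          exact hr i ⟨e, h⟩
      · intro h
        apply Q.loopless e
        rw [← d.graftEnds_inl_map_proj]
        exact ((Sym2.isDiag_map hfV.1).1 h).map
    · refine (P.ends_y i e).trans ?_
      rw [Insertion.graftEnds, Sum.elim_inr, Sym2.map_map]
      rfl
  refine ⟨⟨d, ⟨(Equiv.ofBijective fV hfV, Equiv.ofBijective _ P.edges_bij), hends⟩⟩, ?_⟩
  refine Presentation.ext rfl rfl ?_ rfl rfl
  funext w
  obtain ⟨w, rfl⟩ := hfV.2 w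
  rw [hpf]
  exact congrArg d.proj (Equiv.ofBijective_symm_apply_apply fV hfV w)

end FeynmanDiagram

/-! ### Presentations and extractions -/

namespace FeynmanDiagram

variable {I : Type} {K : I → FeynmanDiagram} {Q G : FeynmanDiagram}

lemma mk_eq_of_mem_ends {S : Set G.E} {e : G.E} (he : e ∈ S) {u v : G.V} (hu : u ∈ G.ends e)
    (hv : v ∈ G.ends e) : Quotient.mk (linked G.ends S) u = Quotient.mk _ v := by
  by_cases huv : u = v
  · rw [huv]
  · exact Quotient.sound
      (Relation.EqvGen.rel _ _ ⟨e, he, (Sym2.mem_and_mem_iff huv).1 ⟨hu, hv⟩⟩)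

/-- The piece to which an edge of the subgraph belongs. -/
def pieceOf {S : Set G.E} (e : G.E) (he : e ∈ S) : G.Piece S :=
  ⟨Quotient.mk _ (G.ends e).out.1, e, he, fun _ hv => mk_eq_of_mem_ends he hv (Sym2.out_fst_mem _)⟩

lemma mk_eq_pieceOf {S : Set G.E} {e : G.E} (he : e ∈ S) {v : G.V} (hv : v ∈ G.ends e) :
    Quotient.mk (linked G.ends S) v = (pieceOf e he).1 :=
  mk_eq_of_mem_ends he hv (Sym2.out_fst_mem _)

/-- A vertex that lies in no piece is not linked to any other vertex. -/
lemma eq_of_linked {S : Set G.E} {u v : G.V} (h : linked G.ends S u v)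
    (hu : ∀ c : G.Piece S, Quotient.mk _ u ≠ c.1) : u = v := by
  suffices ∀ u v, linked G.ends S u v → u = v ∨ ∃ c : G.Piece S, Quotient.mk _ u = c.1 by
    obtain h | ⟨c, hc⟩ := this u v h
    · exact h
    · exact absurd hc (hu c)
  intro u v h
  induction h with
  | rel u v h =>
    obtain ⟨e, he, h⟩ := h
    exact Or.inr ⟨pieceOf e he, mk_eq_pieceOf he (by simp [h])⟩
  | refl u => exact Or.inl rfl
  | symm u v h ih =>
    obtain rfl | ⟨c, hc⟩ := ih
    · exact Or.inl rfl
    · exact Or.inr ⟨c, by rw [← hc]; exact (Quotient.sound h).symm⟩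
  | trans u v w _ _ ih1 ih2 =>
    obtain rfl | h := ih1
    · exact ih2
    · exact Or.inr h

lemma extract_ends_map_val (S : Set G.E) (c : G.Piece S)
    (e : {e : G.E // e ∈ S ∧ ∀ v ∈ G.ends e, Quotient.mk (linked G.ends S) v = c.1}) :
    ((G.extract S c).ends e).map Subtype.val = G.ends e.1 :=
  Sym2.attachWith_map_subtypeVal _

/-- The ways of identifying the diagrams `K i` with the connected pieces of the subgraph with edge
set `S`. -/
abbrev PieceMatching (K : I → FeynmanDiagram) (G : FeynmanDiagram) (S : Set G.E) : Type :=
  Σ σ : I ≃ G.Piece S, ∀ i, Iso (K i) (G.extract S (σ i))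

/-- The presentation given by a subgraph whose pieces are identified with the `K i` and whose
contraction is identified with `Q`. -/
def presentationOfExtraction
    (z : Σ S : {S : Set G.E // G.Contractible S},
      PieceMatching K G S.1 × Iso Q (G.contract S.1 S.2)) : Presentation K Q G := by
  obtain ⟨⟨S, hS⟩, ⟨σ, f⟩, g⟩ := z
  let fV : ∀ i, (K i).V ≃ {v : G.V // Quotient.mk (linked G.ends S) v = (σ i).1} :=
    fun i => (f i).1.1
  let fE : ∀ i, (K i).E ≃ {e : G.E // e ∈ S ∧
    ∀ v ∈ G.ends e, Quotient.mk (linked G.ends S) v = (σ i).1} := fun i => (f i).1.2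
  let gV : Q.V ≃ Quotient (linked G.ends S) := g.1.1
  let gE : Q.E ≃ {e : G.E // e ∉ S} := g.1.2
  exact
  { a i u := (fV i u).1
    y i e := (fE i e).1
    p w := gV.symm (Quotient.mk _ w)
    x e := (gE e).1
    ι i := gV.symm (σ i).1
    ι_inj := gV.symm.injective.comp (Subtype.val_injective.comp σ.injective)
    p_a i u := by rw [(fV i u).2]
    a_inj i := Subtype.val_injective.comp (fV i).injective
    exists_a i w h := by
      obtain ⟨u, hu⟩ := (fV i).surjective ⟨w, gV.symm.injective h⟩
      exact ⟨u, congrArg Subtype.val hu⟩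
    p_inj w w' h h' := by
      refine eq_of_linked (Quotient.exact (gV.symm.injective h)) fun c hc => h' ?_
      obtain ⟨i, rfl⟩ := σ.surjective c
      exact ⟨i, by rw [hc]⟩
    p_surj := gV.symm.surjective.comp Quotient.mk_surjective
    edges_bij := by
      -- Every edge of `S` lies in exactly one piece, and the remaining edges are those of `Q`.
      have hpiece : ∀ i e, pieceOf (fE i e).1 (fE i e).2.1 = σ i := fun i e =>
        Subtype.ext ((fE i e).2.2 _ (Sym2.out_fst_mem _))
      constructor
      · rintro (e | ⟨i, e⟩) (e' | ⟨i', e'⟩) h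
        · rw [gE.injective (Subtype.ext h)]
        · have h : (gE e).1 = (fE i' e').1 := h
          exact absurd (by rw [h]; exact (fE i' e').2.1) (gE e).2
        · have h : (fE i e).1 = (gE e').1 := h
          exact absurd (by rw [← h]; exact (fE i e).2.1) (gE e').2
        · have h : (fE i e).1 = (fE i' e').1 := h
          obtain rfl : i = i' := by
            apply σ.injective
            rw [← hpiece i e, ← hpiece i' e']
            congr 1
          rw [(fE i).injective (Subtype.ext h)]
      · intro e
        by_cases he : e ∈ S
        · obtain ⟨i, hi⟩ := σ.surjective (pieceOf e he)
          obtain ⟨e', he'⟩ := (fE i).surjective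
            ⟨e, he, fun v hv => by rw [hi]; exact mk_eq_pieceOf he hv⟩
          exact ⟨Sum.inr ⟨i, e'⟩, congrArg Subtype.val he'⟩
        · obtain ⟨e', he'⟩ := gE.surjective ⟨e, he⟩
          exact ⟨Sum.inl e', congrArg Subtype.val he'⟩
    ends_y i e := by
      rw [← extract_ends_map_val S (σ i) (fE i e)]
      have h : (G.extract S (σ i)).ends (fE i e) = ((K i).ends e).map (fV i) := (f i).2 e
      refine (congrArg _ h).trans ?_
      rw [Sym2.map_map]
      rfl
    ends_x e := by
      have h : (G.ends (gE e).1).map (Quotient.mk (linked G.ends S)) = (Q.ends e).map gV := g.2 e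
      have h' : (fun w => gV.symm (Quotient.mk (linked G.ends S) w)) =
        gV.symm ∘ Quotient.mk (linked G.ends S) := rfl
      rw [h', ← Sym2.map_map, h, Sym2.map_map, Equiv.symm_comp_self, Sym2.map_id, id] }

lemma presentationOfExtraction_injective :
    Function.Injective (presentationOfExtraction (K := K) (Q := Q) (G := G)) := by
  -- The subgraph is recovered as the complement of the edges that come from `Q`.
  have hrange : ∀ (S : Set G.E) hS σ f g,
      S = {e | ∀ e',
        (presentationOfExtraction (K := K) (Q := Q) ⟨⟨S, hS⟩, ⟨σ, f⟩, g⟩).x e' ≠ e} := by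
    intro S hS σ f g
    let gE : Q.E ≃ {e : G.E // e ∉ S} := g.1.2
    ext e
    constructor
    · rintro he e' rfl
      exact (gE e').2 he
    · intro he
      by_contra h
      obtain ⟨e', he'⟩ := gE.surjective ⟨e, h⟩
      exact he e' (congrArg Subtype.val he')
  rintro ⟨⟨S, hS⟩, ⟨σ, f⟩, g⟩ ⟨⟨S', hS'⟩, ⟨σ', f'⟩, g'⟩ h
  obtain rfl : S = S' := by
    rw [hrange S hS σ f g, hrange S' hS' σ' f' g', h]
  have ha : ∀ i u, ((f i).1.1 u).1 = ((f' i).1.1 u).1 := fun i u =>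
    congrFun (congrFun (congrArg Presentation.a h) i) u
  have hy : ∀ i e, ((f i).1.2 e).1 = ((f' i).1.2 e).1 := fun i e =>
    congrFun (congrFun (congrArg Presentation.y h) i) e
  have hx : ∀ e, (g.1.2 e).1 = (g'.1.2 e).1 := fun e =>
    congrFun (congrArg Presentation.x h) e
  have hp : ∀ w, g.1.1.symm (Quotient.mk _ w) = g'.1.1.symm (Quotient.mk _ w) := fun w =>
    congrFun (congrArg Presentation.p h) w
  obtain rfl : σ = σ' := by
    ext i
    apply Subtype.ext
    obtain ⟨u⟩ : Nonempty (K i).V := inferInstance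
    rw [← ((f i).1.1 u).2, ← ((f' i).1.1 u).2, ha]
  obtain rfl : f = f' := by
    funext i
    exact Subtype.ext (Prod.ext (Equiv.ext fun u => Subtype.ext (ha i u))
      (Equiv.ext fun e => Subtype.ext (hy i e)))
  obtain rfl : g = g' := by
    refine Subtype.ext (Prod.ext (Equiv.symm_bijective.injective (Equiv.ext fun c => ?_))
      (Equiv.ext fun e => Subtype.ext (hx e)))
    obtain ⟨w, rfl⟩ := Quotient.mk_surjective c
    exact hp w
  rfl

namespace Presentation

variable (P : Presentation K Q G)

/-- The edges of the presented diagram that come from the inserted diagrams. -/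
def subgraph : Set G.E := {e | ∃ i e', P.y i e' = e}

lemma x_notMem_subgraph (e : Q.E) : P.x e ∉ P.subgraph := by
  rintro ⟨i, e', h⟩
  exact P.x_ne_y e i e' h.symm

/-- The classes that are contracted are the fibres of the projection. -/
lemma linked_subgraph_iff {w w' : G.V} : linked G.ends P.subgraph w w' ↔ P.p w = P.p w' := by
  constructor
  · intro h
    induction h with
    | rel w w' h =>
      obtain ⟨_, ⟨i, e, rfl⟩, h⟩ := h
      rw [P.ends_y] at h
      have key : ∀ v ∈ ((K i).ends e).map (P.a i), P.p v = P.ι i := by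
        intro v hv
        obtain ⟨u, -, rfl⟩ := Sym2.mem_map.1 hv
        exact P.p_a i u
      rw [key w (by simp [h]), key w' (by simp [h])]
    | refl => rfl
    | symm _ _ _ ih => exact ih.symm
    | trans _ _ _ _ _ ih1 ih2 => exact ih1.trans ih2
  · intro h
    by_cases hw : P.p w ∈ Set.range P.ι
    · obtain ⟨i, hi⟩ := hw
      obtain ⟨u, rfl⟩ := P.exists_a i w hi.symm
      obtain ⟨u', rfl⟩ := P.exists_a i w' (by rw [hi, h])
      exact linked_map (S := Set.univ) (S' := P.subgraph) (P.a i) (P.y i) (P.ends_y i)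
        (fun e _ => ⟨i, e, rfl⟩) ((K i).connected u u')
    · rw [P.p_inj w w' h hw]

lemma mk_eq_mk_iff {w w' : G.V} :
    Quotient.mk (linked G.ends P.subgraph) w = Quotient.mk _ w' ↔ P.p w = P.p w' :=
  Quotient.eq.trans P.linked_subgraph_iff

lemma contractible_subgraph : G.Contractible P.subgraph := by
  constructor
  · intro h
    exact P.x_notMem_subgraph (Classical.arbitrary _) (h ▸ Set.mem_univ _)
  · intro e he h
    obtain ⟨e, rfl⟩ | h' := P.exists_edge e
    · apply Q.loopless e
      rw [← P.ends_x]
      generalize G.ends (P.x e) = z at h ⊢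
      induction z with
      | _ u v => simpa [P.mk_eq_mk_iff] using h
    · exact he h'

/-- The vertices of the contracted diagram are the vertices of `Q`. -/
def quotientEquiv : Q.V ≃ Quotient (linked G.ends P.subgraph) :=
  (Equiv.ofBijective (Quotient.lift P.p fun _ _ h => P.linked_subgraph_iff.1 h) (by
    constructor
    · intro c c' h
      obtain ⟨w, rfl⟩ := Quotient.mk_surjective c
      obtain ⟨w', rfl⟩ := Quotient.mk_surjective c'
      exact P.mk_eq_mk_iff.2 h
    · intro v
      obtain ⟨w, rfl⟩ := P.p_surj v
      exact ⟨Quotient.mk _ w, rfl⟩)).symm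

lemma quotientEquiv_symm_mk (w : G.V) : P.quotientEquiv.symm (Quotient.mk _ w) = P.p w := rfl

lemma quotientEquiv_p (w : G.V) : P.quotientEquiv (P.p w) = Quotient.mk _ w := by
  rw [← P.quotientEquiv_symm_mk, Equiv.apply_symm_apply]

lemma mk_eq_quotientEquiv_iff {w : G.V} {v : Q.V} :
    Quotient.mk _ w = P.quotientEquiv v ↔ P.p w = v := by
  rw [← P.quotientEquiv_symm_mk, Equiv.symm_apply_eq]

/-- The piece of the subgraph that comes from `K i`. -/
def piece (i : I) : G.Piece P.subgraph :=
  ⟨P.quotientEquiv (P.ι i), P.y i (Classical.arbitrary _), ⟨i, _, rfl⟩, fun v hv => by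
    rw [P.ends_y] at hv
    obtain ⟨u, -, rfl⟩ := Sym2.mem_map.1 hv
    rw [P.mk_eq_quotientEquiv_iff, P.p_a]⟩

lemma piece_bijective : Function.Bijective P.piece := by
  constructor
  · intro i j h
    exact P.ι_inj (P.quotientEquiv.injective (congrArg Subtype.val h))
  · rintro ⟨c, e, ⟨i, e', rfl⟩, h⟩
    refine ⟨i, Subtype.ext ?_⟩
    have hu : P.a i ((K i).ends e').out.1 ∈ G.ends (P.y i e') := by
      rw [P.ends_y]
      exact Sym2.mem_map.2 ⟨_, Sym2.out_fst_mem _, rfl⟩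
    exact (P.mk_eq_quotientEquiv_iff.2 (P.p_a i _)).symm.trans (h _ hu)

/-- The edges of the piece that comes from `K i` are the images of the edges of `K i`. -/
lemma mem_subgraph_and_iff {i : I} {e : G.E} :
    (e ∈ P.subgraph ∧ ∀ v ∈ G.ends e, Quotient.mk _ v = (P.piece i).1) ↔ ∃ e', P.y i e' = e := by
  constructor
  · rintro ⟨⟨j, e', rfl⟩, h⟩
    have hu : P.a j ((K j).ends e').out.1 ∈ G.ends (P.y j e') := by
      rw [P.ends_y]
      exact Sym2.mem_map.2 ⟨_, Sym2.out_fst_mem _, rfl⟩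
    have := P.mk_eq_quotientEquiv_iff.1 (h _ hu)
    rw [P.p_a] at this
    obtain rfl := P.ι_inj this
    exact ⟨e', rfl⟩
  · rintro ⟨e', rfl⟩
    refine ⟨⟨i, e', rfl⟩, fun v hv => ?_⟩
    rw [P.ends_y] at hv
    obtain ⟨u, -, rfl⟩ := Sym2.mem_map.1 hv
    exact P.mk_eq_quotientEquiv_iff.2 (P.p_a i u)

/-- The piece that comes from `K i` is isomorphic to `K i`. -/
def pieceIso (i : I) : Iso (K i) (G.extract P.subgraph (P.piece i)) :=
  ⟨(Equiv.ofBijective (fun u => (⟨P.a i u, P.mk_eq_quotientEquiv_iff.2 (P.p_a i u)⟩ :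
        {v : G.V // Quotient.mk (linked G.ends P.subgraph) v = (P.piece i).1}))
      ⟨fun u u' h => P.a_inj i (congrArg Subtype.val h), fun w => by
        obtain ⟨u, hu⟩ := P.exists_a i w.1 (P.mk_eq_quotientEquiv_iff.1 w.2)
        exact ⟨u, Subtype.ext hu⟩⟩,
    Equiv.ofBijective (fun e => (⟨P.y i e, P.mem_subgraph_and_iff.2 ⟨e, rfl⟩⟩ :
        {e : G.E // e ∈ P.subgraph ∧
          ∀ v ∈ G.ends e, Quotient.mk (linked G.ends P.subgraph) v = (P.piece i).1}))
      ⟨fun e e' h => P.y_inj i (congrArg Subtype.val h), fun e => by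
        obtain ⟨e', he⟩ := P.mem_subgraph_and_iff.1 e.2
        exact ⟨e', Subtype.ext he⟩⟩), fun e => by
    apply Sym2.map.injective Subtype.val_injective
    refine (extract_ends_map_val _ _ _).trans ((P.ends_y i e).trans ?_)
    generalize (K i).ends e = z
    induction z with
    | _ u v => rfl⟩

/-- The contracted diagram is isomorphic to `Q`. -/
def contractIso : Iso Q (G.contract P.subgraph P.contractible_subgraph) :=
  ⟨(P.quotientEquiv,
    Equiv.ofBijective (fun e => (⟨P.x e, P.x_notMem_subgraph e⟩ : {e : G.E // e ∉ P.subgraph}))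
      ⟨fun e e' h => P.x_inj (congrArg Subtype.val h), fun e => by
        obtain ⟨e', he⟩ | h := P.exists_edge e.1
        · exact ⟨e', Subtype.ext he⟩
        · exact absurd h e.2⟩), fun e => by
    change (G.ends (P.x e)).map (Quotient.mk _) = (Q.ends e).map P.quotientEquiv
    rw [← P.ends_x, Sym2.map_map]
    refine congrArg (fun f => Sym2.map f _) ?_
    funext w
    exact (P.quotientEquiv_p w).symm⟩

end Presentation

lemma presentationOfExtraction_surjective :
    Function.Surjective (presentationOfExtraction (K := K) (Q := Q) (G := G)) := by
  intro P
  refine ⟨⟨⟨P.subgraph, P.contractible_subgraph⟩,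
    ⟨Equiv.ofBijective P.piece P.piece_bijective, P.pieceIso⟩, P.contractIso⟩, ?_⟩
  refine Presentation.ext rfl rfl rfl rfl ?_
  funext i
  exact P.quotientEquiv.symm_apply_apply _

variable [Finite I]

instance (G H : FeynmanDiagram) : Finite (Iso G H) :=
  inferInstanceAs (Finite {p : (G.V ≃ H.V) × (G.E ≃ H.E) //
    ∀ e, H.ends (p.2 e) = (G.ends e).map p.1})

lemma card_iso_of_equiv {G H : FeynmanDiagram} (h : G ≈ H) : Nat.card (Iso G H) = G.sym := by
  obtain ⟨f⟩ := h
  refine Nat.card_congr ⟨fun g => g.trans f.symm, fun g => g.trans f, fun g => ?_, fun g => ?_⟩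
  · apply Subtype.ext
    apply Prod.ext <;> ext x <;> simp [Iso.trans, Iso.symm]
  · apply Subtype.ext
    apply Prod.ext <;> ext x <;> simp [Iso.trans, Iso.symm]

open Classical in
lemma card_iso (G H : FeynmanDiagram) : Nat.card (Iso G H) = if G ≈ H then G.sym else 0 := by
  split_ifs with h
  · exact card_iso_of_equiv h
  · have : IsEmpty (Iso G H) := ⟨fun f => h ⟨f⟩⟩
    exact Nat.card_of_isEmpty

/-- Counting the presentations of `G` in two ways. -/
lemma card_graft_mul_sym (K : I → FeynmanDiagram) (Q G : FeynmanDiagram) :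
    Nat.card {d : Insertion K Q // d.graft ≈ G} * G.sym =
      ∑ᶠ S : {S : Set G.E // G.Contractible S},
        Nat.card (PieceMatching K G S.1) * Nat.card (Iso Q (G.contract S.1 S.2)) := by
  classical
  have h1 := Nat.card_congr (Equiv.ofBijective _
    ⟨presentationOfGraft_injective (K := K) (Q := Q) (G := G), presentationOfGraft_surjective⟩)
  have h2 := Nat.card_congr (Equiv.ofBijective _
    ⟨presentationOfExtraction_injective (K := K) (Q := Q) (G := G),
      presentationOfExtraction_surjective⟩)
  have := Fintype.ofFinite (Insertion K Q)
  rw [← h2, Nat.card_sigma, Nat.card_sigma] at h1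
  rw [finsum_eq_sum_of_fintype]
  simp only [Nat.card_prod] at h1
  convert h1 using 1
  simp only [card_iso]
  rw [← Finset.sum_filter, Nat.card_eq_fintype_card, Fintype.card_subtype, ← smul_eq_mul,
    ← Finset.sum_const]
  exact Finset.sum_congr rfl fun d hd => sym_congr (Setoid.symm (Finset.mem_filter.1 hd).2)

end FeynmanDiagram

/-! ### Symmetry factors of forests -/

section Matching

variable {I C X : Type*} [Fintype I] [Fintype C]

open Classical in
lemma count_univ_map (f : I → X) (x : X) :
    (Finset.univ.val.map f).count x = Fintype.card {i // f i = x} := by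
  rw [Multiset.count_map, Fintype.card_subtype, Finset.card_def, Finset.filter_val]
  simp only [eq_comm]

/-- Two enumerations of the same multiset differ by a bijection of the index types. -/
lemma exists_equiv_of_map_eq {f : I → X} {g : C → X}
    (h : Finset.univ.val.map f = Finset.univ.val.map g) : ∃ σ : I ≃ C, ∀ i, g (σ i) = f i := by
  classical
  have e : ∀ x, Nonempty ({i // f i = x} ≃ {c // g c = x}) := fun x => by
    rw [← Fintype.card_eq, ← count_univ_map, ← count_univ_map, h]
  let e := fun x => (e x).some
  exact ⟨Equiv.ofFiberEquiv e, fun i => Equiv.ofFiberEquiv_map e i⟩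

lemma map_eq_of_equiv {f : I → X} {g : C → X} (σ : I ≃ C) (h : ∀ i, g (σ i) = f i) :
    Finset.univ.val.map f = Finset.univ.val.map g := by
  rw [← Finset.map_univ_equiv σ, Finset.map_val, Multiset.map_map]
  exact Multiset.map_congr rfl fun i _ => (h i).symm

open Classical in
/-- The number of bijections that match two enumerations of a multiset. -/
lemma card_matching {f : I → X} {g : C → X}
    (h : Finset.univ.val.map f = Finset.univ.val.map g) :
    Nat.card {σ : I ≃ C // ∀ i, g (σ i) = f i} =
      ∏ x ∈ (Finset.univ.val.map f).toFinset, ((Finset.univ.val.map f).count x)! := by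
  obtain ⟨σ, hσ⟩ := exists_equiv_of_map_eq h
  -- Composing with one matching turns the matchings into the stabilizer of `f`.
  have e : {σ : I ≃ C // ∀ i, g (σ i) = f i} ≃ {τ : Equiv.Perm I // f ∘ τ = f} := by
    refine (Equiv.equivCongr (Equiv.refl I) σ.symm).subtypeEquiv fun τ => ?_
    rw [funext_iff]
    refine forall_congr' fun i => ?_
    simp [← hσ]
  rw [Nat.card_congr e, Nat.card_eq_fintype_card, DomMulAct.stabilizer_card']
  simp only [count_univ_map]
  refine Finset.prod_congr ?_ fun _ _ => rfl
  ext x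
  simp

lemma forestSym_univ_map (S : X → ℕ) (f : I → X) [DecidableEq X] :
    forestSym S (Finset.univ.val.map f) =
      (∏ x ∈ (Finset.univ.val.map f).toFinset, ((Finset.univ.val.map f).count x)!) *
        ∏ i, S (f i) := by
  have h : ∏ i, S (f i) = ((Finset.univ.val.map f).map S).prod := by
    rw [Multiset.map_map]; rfl
  rw [h, Finset.prod_multiset_map_count, ← Finset.prod_mul_distrib, forestSym]
  convert rfl

end Matching

namespace FeynmanDiagram

/-- The isomorphism class of a diagram. -/
def toFD (G : FeynmanDiagram) : FD := Quotient.mk _ G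

lemma toFD_eq_iff {G H : FeynmanDiagram} : G.toFD = H.toFD ↔ G ≈ H := Quotient.eq

@[simp] lemma toFD_count (G : FeynmanDiagram) : G.toFD.count = G.count := rfl

/-- The multiset of isomorphism classes of a finite family of diagrams. -/
def forestOf {I : Type} [Fintype I] (K : I → FeynmanDiagram) : FDForest :=
  Finset.univ.val.map fun i => (K i).toFD

/-- The pieces of a subgraph, as a forest of isomorphism classes. -/
def pieceForest (G : FeynmanDiagram) (S : Set G.E) : FDForest := forestOf (G.extract S)

variable {I : Type} [Fintype I]

open Classical in
/-- The symmetry factor of a forest counts the isomorphisms onto the pieces of a subgraph. -/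
lemma card_pieceMatching (K : I → FeynmanDiagram) (G : FeynmanDiagram) (S : Set G.E) :
    Nat.card (PieceMatching K G S) =
      if G.pieceForest S = forestOf K then forestSym FD.sym (forestOf K) else 0 := by
  have hiso : ∀ (σ : I ≃ G.Piece S) i, Nat.card (Iso (K i) (G.extract S (σ i))) =
      if (G.extract S (σ i)).toFD = (K i).toFD then (K i).sym else 0 := by
    intro σ i
    rw [card_iso]
    refine if_congr ?_ rfl rfl
    rw [eq_comm, toFD_eq_iff]
  have h1 : Nat.card (PieceMatching K G S) =
      Nat.card {σ : I ≃ G.Piece S // ∀ i, (G.extract S (σ i)).toFD = (K i).toFD} *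
        ∏ i, (K i).toFD.sym := by
    rw [Nat.card_sigma]
    simp only [Nat.card_pi, hiso, Finset.prod_ite_zero, Finset.mem_univ, true_imp_iff]
    rw [← Finset.sum_filter, Finset.sum_const, smul_eq_mul, Nat.card_eq_fintype_card,
      Fintype.card_subtype]
    rfl
  rw [h1]
  split_ifs with h
  · rw [forestOf, forestSym_univ_map]
    rw [← card_matching (g := fun c => (G.extract S c).toFD) h.symm]
  · have : IsEmpty {σ : I ≃ G.Piece S // ∀ i, (G.extract S (σ i)).toFD = (K i).toFD} :=
      ⟨fun σ => h (map_eq_of_equiv (g := fun c => (G.extract S c).toFD) σ.1 σ.2).symm⟩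
    rw [Nat.card_of_isEmpty, zero_mul]

/-- The two counts of presentations, as a relation between symmetry factors: insertions of the `K i`
into `Q` with result `G` against subgraphs of `G` with pieces `K i` and contraction `Q`. -/
lemma card_graft_mul_sym_eq (K : I → FeynmanDiagram) (Q G : FeynmanDiagram) :
    Nat.card {d : Insertion K Q // d.graft ≈ G} * G.sym =
      forestSym FD.sym (forestOf K) * Q.sym *
        Nat.card {S : {S : Set G.E // G.Contractible S} //
          G.pieceForest S.1 = forestOf K ∧ (G.contract S.1 S.2).toFD = Q.toFD} := by
  classical
  rw [card_graft_mul_sym, finsum_eq_sum_of_fintype, Nat.card_eq_fintype_card,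
    Fintype.card_subtype, Finset.card_filter, Finset.mul_sum]
  refine Finset.sum_congr rfl fun S _ => ?_
  rw [card_pieceMatching, card_iso, ite_zero_mul_ite_zero, ← toFD_eq_iff, mul_ite, mul_one,
    mul_zero]
  refine if_congr (and_congr Iff.rfl eq_comm) rfl rfl

end FeynmanDiagram

/-! ### Insertion of multi-indices as a sum over insertions of diagrams -/

section Derivations

open MvPolynomial

lemma derivation_finset_prod {ι : Type*} [DecidableEq ι]
    (D : Derivation ℝ (MvPolynomial ℕ ℝ) (MvPolynomial ℕ ℝ)) (s : Finset ι)
    (f : ι → MvPolynomial ℕ ℝ) :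
    D (∏ i ∈ s, f i) = ∑ i ∈ s, (∏ j ∈ s.erase i, f j) * D (f i) := by
  induction s using Finset.induction_on with
  | empty => simp
  | insert a s ha ih =>
    rw [Finset.prod_insert ha, Derivation.leibniz, ih, Finset.sum_insert ha,
      Finset.erase_insert ha, smul_eq_mul, smul_eq_mul, Finset.mul_sum, add_comm]
    refine congrArg₂ _ rfl (Finset.sum_congr rfl fun i hi => ?_)
    have hai : a ≠ i := by rintro rfl; exact ha hi
    rw [Finset.erase_insert_of_ne hai, Finset.prod_insert (by simp [ha]), mul_assoc]

lemma pderiv_prod_X {U : Type*} [DecidableEq U] (k : ℕ) (s : Finset U) (a : U → ℕ) :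
    pderiv k (∏ u ∈ s, X (a u) : MvPolynomial ℕ ℝ) =
      ∑ w ∈ s, if a w = k then ∏ u ∈ s.erase w, X (a u) else 0 := by
  rw [derivation_finset_prod]
  refine Finset.sum_congr rfl fun w _ => ?_
  rw [pderiv_X, Pi.single_apply, mul_ite, mul_one, mul_zero]

variable {U : Type*} [Fintype U]

lemma derivD_prod_X [DecidableEq U] (a : U → ℕ) :
    derivD (∏ u, X (a u)) = ∑ w, ∏ u, X (a u + if w = u then 1 else 0) := by
  rw [derivation_finset_prod]
  refine Finset.sum_congr rfl fun w _ => ?_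
  rw [← Finset.prod_erase_mul _ _ (Finset.mem_univ w), if_pos rfl]
  congr 1
  · refine Finset.prod_congr rfl fun u hu => ?_
    rw [if_neg (Finset.ne_of_mem_erase hu).symm, add_zero]
  · rw [derivD, mkDerivation_X]

/-- Iterating `D` distributes new legs over the vertices in all possible ways. -/
lemma iterate_derivD_prod_X [DecidableEq U] (n : ℕ) (a : U → ℕ) :
    derivD^[n] (∏ u, X (a u)) =
      ∑ r : Fin n → U, ∏ u, X (a u + ∑ j, if r j = u then 1 else 0) := by
  induction n with
  | zero => simp
  | succ n ih =>
    rw [Function.iterate_succ_apply', ih, map_sum, ← (Fin.consEquiv fun _ => U).sum_comp,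
      Fintype.sum_prod_type_right]
    refine Finset.sum_congr rfl fun r _ => ?_
    rw [derivD_prod_X]
    refine Finset.sum_congr rfl fun w _ => Finset.prod_congr rfl fun u _ => ?_
    rw [Fin.sum_univ_succ, add_assoc]
    congr 2
    rw [add_comm]
    rfl

/-- The legs may be indexed by an arbitrary finite type. -/
lemma iterate_derivD_card_prod_X (J : Type*) [Fintype J] [DecidableEq J] (a : U → ℕ) :
    derivD^[Nat.card J] (∏ u, X (a u)) =
      ∑ r : J → U, ∏ u, X (a u + Nat.card {j // r j = u}) := by
  classical
  rw [iterate_derivD_prod_X, Nat.card_eq_fintype_card]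
  refine Fintype.sum_equiv ((Fintype.equivFin J).symm.arrowCongr (Equiv.refl U)) _ _ fun r =>
    Finset.prod_congr rfl fun u _ => ?_
  congr 2
  rw [Nat.card_eq_fintype_card, Fintype.card_subtype, Finset.card_filter]
  exact Fintype.sum_equiv (Fintype.equivFin J).symm _ _ fun j => by simp

open Classical in
/-- Iterated partial derivatives remove vertices of prescribed arities in all possible ways. -/
lemma prod_pderiv_prod_X (n : ℕ) (k : Fin n → ℕ) (a : U → ℕ) :
    (List.ofFn fun i => ((pderiv (k i)).toLinearMap : Module.End ℝ (MvPolynomial ℕ ℝ))).prod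
        (∏ u, X (a u)) =
      ∑ t : Fin n → U, if Function.Injective t ∧ (fun i => a (t i)) = k then
        ∏ u ∈ Finset.univ.filter (· ∉ Set.range t), X (a u) else 0 := by
  induction n with
  | zero =>
    rw [Fintype.sum_unique, if_pos ⟨Function.injective_of_subsingleton _, Subsingleton.elim _ _⟩]
    simp
  | succ n ih =>
    rw [List.ofFn_succ, List.prod_cons, Module.End.mul_apply, ih fun i => k i.succ, map_sum,
      ← (Fin.consEquiv fun _ => U).sum_comp, Fintype.sum_prod_type_right]
    refine Finset.sum_congr rfl fun t _ => ?_
    have hcons : ∀ w, (Fin.consEquiv fun _ => U) (w, t) = Fin.cons w t := fun _ => rfl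
    have hk : ∀ w, ((fun i => a ((Fin.cons w t : Fin (n + 1) → U) i)) = k) ↔
        a w = k 0 ∧ (fun i => a (t i)) = fun i => k i.succ := by
      intro w
      rw [funext_iff, Fin.forall_fin_succ, funext_iff]
      simp
    simp only [hcons, Fin.cons_injective_iff, hk]
    by_cases h : Function.Injective t ∧ (fun i => a (t i)) = fun i => k i.succ
    · rw [if_pos h]
      refine (pderiv_prod_X _ _ _).trans ?_
      rw [Finset.sum_filter]
      refine Finset.sum_congr rfl fun w _ => ?_
      by_cases hw : w ∈ Set.range t
      · rw [if_neg (by simpa using hw), if_neg (fun h' => h'.1.1 hw)]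
      · rw [if_pos hw]
        refine if_congr (by tauto) (Finset.prod_congr ?_ fun _ _ => rfl) rfl
        ext u
        simp [Fin.range_cons]
    · rw [if_neg h, map_zero]
      refine (Finset.sum_eq_zero fun w _ => ?_).symm
      rw [if_neg (by tauto)]

end Derivations

namespace FeynmanDiagram

open MvPolynomial

lemma monomial_count (G : FeynmanDiagram) :
    (monomial G.count 1 : MvPolynomial ℕ ℝ) = ∏ v, X (G.arity v) := by
  rw [count, monomial_sum_one]
  rfl

lemma arity_mem_support_count (G : FeynmanDiagram) (v : G.V) : G.arity v ∈ G.count.support := by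
  rw [Finsupp.mem_support_iff, count, Finsupp.finsetSum_apply]
  refine (lt_of_lt_of_le zero_lt_one ?_).ne'
  refine le_trans (le_of_eq ?_) (Finset.single_le_sum
    (f := fun w => Finsupp.single (G.arity w) 1 (G.arity v)) (fun _ _ => Nat.zero_le _)
    (Finset.mem_univ v))
  simp

lemma toMI_mono (G : FeynmanDiagram) : G.toFD.toMI.mono = ∏ v, X (G.arity v) :=
  G.monomial_count

open Classical in
lemma monomial_count_graft {I : Type} [Fintype I] {K : I → FeynmanDiagram} {Q : FeynmanDiagram}
    (d : Insertion K Q) :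
    (monomial d.graft.count 1 : MvPolynomial ℕ ℝ) =
      (∏ i, ∏ u, X ((K i).arity u + Nat.card {e // d.2 i e = u})) *
        ∏ v ∈ Finset.univ.filter (· ∉ Set.range d.1), X (Q.arity v) := by
  have h : (∏ v : d.graft.V, X (d.graft.arity v) : MvPolynomial ℕ ℝ) =
      ∏ v : d.Vert, X (d.graft.arity v) :=
    Fintype.prod_equiv (ι := d.graft.V) (κ := d.Vert) (Equiv.refl _) _ _ fun _ => rfl
  have h' : (∏ v ∈ Finset.univ.filter (· ∉ Set.range d.1), X (Q.arity v) : MvPolynomial ℕ ℝ) =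
      ∏ v : {v // v ∉ Set.range d.1}, X (Q.arity v.1) := Finset.prod_subtype _ (by simp) _
  rw [monomial_count, h, h', Fintype.prod_sum_type, Fintype.prod_sigma, mul_comm]
  simp only [Insertion.arity_graft_inl, Insertion.arity_graft_inr]

/-- Inserting multi-indices that count diagrams amounts to inserting the diagrams. -/
lemma insertionList_eq_finsum (l : List MI) (K : Fin l.length → FeynmanDiagram)
    (Q : FeynmanDiagram) (hl : ∀ i, l.get i = (K i).toFD.toMI) :
    insertionList l Q.toFD.toMI = ∑ᶠ d : Insertion K Q, monomial d.graft.count 1 := by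
  classical
  let R (t : Fin l.length → Q.V) : MvPolynomial ℕ ℝ :=
    ∏ v ∈ Finset.univ.filter (· ∉ Set.range t), X (Q.arity v)
  let L (k : Fin l.length → ℕ) : MvPolynomial ℕ ℝ :=
    ∏ i, derivD^[k i] (∏ u, X ((K i).arity u))
  -- The tuple `k` is determined by the vertices that are removed: `k i` is the arity of `t i`.
  have h1 : insertionList l Q.toFD.toMI =
      ∑ t : Fin l.length → Q.V, if Function.Injective t then
        L (fun i => Q.arity (t i)) * R t else 0 := by
    simp only [insertionList, hl, toMI_mono, prod_pderiv_prod_X, Finset.mul_sum]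
    rw [Finset.sum_comm]
    refine Finset.sum_congr rfl fun t _ => ?_
    by_cases ht : Function.Injective t
    · rw [if_pos ht, Finset.sum_eq_single (fun i => Q.arity (t i))]
      · rw [if_pos ⟨ht, rfl⟩]
      · intro k _ hk
        rw [if_neg (fun h => hk h.2.symm), mul_zero]
      · intro h
        exact absurd (Fintype.mem_piFinset.2 fun i => Q.arity_mem_support_count (t i)) h
    · simp only [ht, false_and, if_false, mul_zero, Finset.sum_const_zero]
  have h2 : ∀ ι : Fin l.length ↪ Q.V, L (fun i => Q.arity (ι i)) * R ι =
      ∑ r : ∀ i, {e : Q.E // ι i ∈ Q.ends e} → (K i).V,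
        monomial (Insertion.graft ⟨ι, r⟩).count 1 := by
    intro ι
    have hD : ∀ i, derivD^[Q.arity (ι i)] (∏ u, X ((K i).arity u)) =
        ∑ r : {e : Q.E // ι i ∈ Q.ends e} → (K i).V,
          ∏ u, X ((K i).arity u + Nat.card {e // r e = u}) := fun i =>
      iterate_derivD_card_prod_X _ _
    simp only [monomial_count_graft, L, hD]
    rw [Finset.prod_univ_sum, Fintype.piFinset_univ, Finset.sum_mul]
  rw [h1, ← Finset.sum_filter, Finset.sum_subtype (p := Function.Injective) _ (by simp),
    finsum_eq_sum_of_fintype, Fintype.sum_sigma]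
  exact Fintype.sum_equiv (Equiv.subtypeInjectiveEquivEmbedding _ _) _ _ fun t => h2 ⟨t.1, t.2⟩

/-- The coefficients of an insertion of multi-indices count insertions of diagrams. -/
lemma coeff_insertionList (l : List MI) (K : Fin l.length → FeynmanDiagram)
    (Q : FeynmanDiagram) (hl : ∀ i, l.get i = (K i).toFD.toMI) (β : ℕ →₀ ℕ) :
    (insertionList l Q.toFD.toMI).coeff β =
      (Nat.card {d : Insertion K Q // d.graft.count = β} : ℝ) := by
  classical
  have := Fintype.ofFinite (Insertion K Q)
  rw [insertionList_eq_finsum l K Q hl, finsum_eq_sum_of_fintype, coeff_sum]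
  simp only [coeff_monomial]
  rw [Finset.sum_boole, Nat.card_eq_fintype_card, Fintype.card_subtype]

end FeynmanDiagram

/-! ### Degrees and positivity of symmetry factors -/

namespace FeynmanDiagram

/-- The handshake identity: each edge is counted at its two endpoints. -/
lemma wt_count_eq (G : FeynmanDiagram) : wt G.count = 2 * Nat.card G.E := by
  classical
  have h1 : ∑ v : G.V, G.arity v = ∑ e : G.E, Fintype.card {v : G.V // v ∈ G.ends e} := by
    have : ∀ v, G.arity v = ∑ e : G.E, if v ∈ G.ends e then 1 else 0 := fun v => by
      rw [arity, Nat.card_eq_fintype_card, Fintype.card_subtype, Finset.card_filter]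
    simp only [this, Fintype.card_subtype, Finset.card_filter]
    exact Finset.sum_comm
  have h2 : ∀ e : G.E, Fintype.card {v : G.V // v ∈ G.ends e} = 2 := fun e => by
    rw [← Sym2.card_toFinset_of_not_isDiag _ (G.loopless e)]
    exact Fintype.card_of_subtype _ fun v => Sym2.mem_toFinset
  rw [wt_count, h1, Nat.card_eq_fintype_card]
  simp [h2, mul_comm]

lemma deg_toMI (ℓ : ℝ) (d : ℕ) (G : FeynmanDiagram) : G.toFD.toMI.deg ℓ d = G.deg ℓ d := by
  have h1 : (G.count.sum fun k m => (k : ℝ) * (m : ℝ)) = 2 * (Nat.card G.E : ℝ) := by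
    have := congrArg (Nat.cast (R := ℝ)) G.wt_count_eq
    rw [wt, Finsupp.sum, Nat.cast_sum] at this
    push_cast at this
    rw [← this, Finsupp.sum]
    exact Finset.sum_congr rfl fun _ _ => mul_comm _ _
  have h2 : (G.count.sum fun _ m => (m : ℝ)) = (Nat.card G.V : ℝ) := by
    rw [Nat.card_eq_fintype_card, G.card_V, Finsupp.sum, Finsupp.sum, Nat.cast_sum]
  change ℓ / 2 * (G.count.sum fun k m => (k : ℝ) * (m : ℝ)) +
    (d : ℝ) * ((G.count.sum fun _ m => (m : ℝ)) - 1) = _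
  rw [h1, h2, deg]
  ring

lemma sym_pos (G : FeynmanDiagram) : 0 < G.sym :=
  Nat.card_pos_iff.2 ⟨⟨Iso.refl G⟩, inferInstance⟩

end FeynmanDiagram

lemma FD.sym_pos (G : FD) : 0 < G.sym := by
  induction G using Quotient.inductionOn with
  | h G => exact G.sym_pos

lemma MI.sym_pos (β : MI) : 0 < β.sym :=
  Finset.prod_pos fun _ _ => Nat.mul_pos (Nat.factorial_pos _) (pow_pos (Nat.factorial_pos _) _)

lemma forestSym_pos {X : Type*} {S : X → ℕ} (hS : ∀ x, 0 < S x) (s : Multiset X) :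
    0 < forestSym S s :=
  Finset.prod_pos fun _ _ => Nat.mul_pos (Nat.factorial_pos _) (pow_pos (hS _) _)

/-! ### Coefficients of the lifts and of the coproducts -/

/-- The insertion of a forest of multi-indices is computed along the arbitrary enumeration `toList`;
any forest of diagrams that it counts can be enumerated compatibly. -/
lemma exists_forestOf_eq (F : FDForest) :
    ∃ K : Fin (F.map FD.toMI).toList.length → FeynmanDiagram,
      FeynmanDiagram.forestOf K = F ∧
        ∀ i, (F.map FD.toMI).toList.get i = (K i).toFD.toMI := by
  have hF : Finset.univ.val.map F.toList.get = F := by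
    rw [Fin.univ_val_map, List.ofFn_get, Multiset.coe_toList]
  have h : Finset.univ.val.map (F.map FD.toMI).toList.get =
      Finset.univ.val.map fun i => (F.toList.get i).toMI := by
    rw [Fin.univ_val_map, List.ofFn_get, Multiset.coe_toList]
    conv_lhs => rw [← hF, Multiset.map_map]
    rfl
  obtain ⟨σ, hσ⟩ := exists_equiv_of_map_eq h
  have hout : ∀ i, (Quotient.out (F.toList.get (σ i))).toFD = F.toList.get (σ i) := fun i =>
    Quotient.out_eq _
  refine ⟨fun i => Quotient.out (F.toList.get (σ i)), ?_, fun i => ?_⟩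
  · simp only [FeynmanDiagram.forestOf, hout]
    rw [map_eq_of_equiv σ fun i => rfl, hF]
  · rw [hout, hσ]

open Classical in
lemma liftP_single_apply (β : MI) (G : FD) :
    liftP (Finsupp.single β 1) G = if G.toMI = β then (β.sym : ℝ) / (G.sym : ℝ) else 0 := by
  rw [liftP, Finsupp.linearCombination_single, one_smul, Finsupp.finsetSum_apply]
  simp only [Finsupp.single_apply]
  rw [Finset.sum_ite_eq']
  refine if_congr ?_ rfl rfl
  rw [Set.Finite.mem_toFinset]
  exact ⟨fun h => Subtype.ext h, fun h => congrArg Subtype.val h⟩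

open Classical in
lemma liftForestP_single_apply (b : MIForest) (F : FDForest) :
    liftForestP (Finsupp.single b 1) F = if F.map FD.toMI = b then
      (forestSym MI.sym b : ℝ) / (forestSym FD.sym F : ℝ) else 0 := by
  rw [liftForestP, Finsupp.linearCombination_single, one_smul, Finsupp.finsetSum_apply]
  simp only [Finsupp.single_apply]
  rw [Finset.sum_ite_eq']
  refine if_congr ?_ rfl rfl
  rw [Set.Finite.mem_toFinset]
  rfl

/-- The coefficient of `F ⊗ G` in a tensor. -/
def tensorCoeff (F : FDForest) (G : FD) : (FDForest →₀ ℝ) ⊗[ℝ] (FD →₀ ℝ) →ₗ[ℝ] ℝ :=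
  Finsupp.lapply (F, G) ∘ₗ (finsuppTensorFinsupp' ℝ FDForest FD).toLinearMap

lemma tensorCoeff_tmul (F : FDForest) (G : FD) (x : FDForest →₀ ℝ) (y : FD →₀ ℝ) :
    tensorCoeff F G (x ⊗ₜ[ℝ] y) = x F * y G :=
  finsuppTensorFinsupp'_apply_apply _ _ _ _ _ _ _

lemma ext_tensorCoeff {x y : (FDForest →₀ ℝ) ⊗[ℝ] (FD →₀ ℝ)}
    (h : ∀ F G, tensorCoeff F G x = tensorCoeff F G y) : x = y :=
  (finsuppTensorFinsupp' ℝ FDForest FD).injective (Finsupp.ext fun p => h p.1 p.2)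

open Classical in
lemma tensorCoeff_lift_coproductM (ℓ : ℝ) (d : ℕ) (β : MI) (F : FDForest) (G : FD) :
    tensorCoeff F G (TensorProduct.map liftForestP liftP (coproductM ℓ d (Finsupp.single β 1))) =
      if MIForest.Divergent ℓ d (F.map FD.toMI) then
        pairing (insertion (F.map FD.toMI) G.toMI) β / (forestSym FD.sym F * G.sym) else 0 := by
  rw [coproductM, Finsupp.linearCombination_single, one_smul, map_sum, map_sum]
  simp only [map_smul, TensorProduct.map_tmul, tensorCoeff_tmul, liftP_single_apply,
    liftForestP_single_apply, ite_zero_mul_ite_zero, smul_eq_mul]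
  rw [Finset.sum_eq_single (F.map FD.toMI, G.toMI)]
  · rw [if_pos ⟨rfl, rfl⟩, coproductCoeff]
    split_ifs
    · have h1 : (forestSym MI.sym (F.map FD.toMI) : ℝ) ≠ 0 :=
        Nat.cast_ne_zero.2 (forestSym_pos MI.sym_pos _).ne'
      have h2 : (G.toMI.sym : ℝ) ≠ 0 := Nat.cast_ne_zero.2 G.toMI.sym_pos.ne'
      have h3 : (forestSym FD.sym F : ℝ) ≠ 0 := Nat.cast_ne_zero.2 (forestSym_pos FD.sym_pos _).ne'
      have h4 : (G.sym : ℝ) ≠ 0 := Nat.cast_ne_zero.2 G.sym_pos.ne'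
      field_simp
    · rw [zero_mul]
  · rintro ⟨b, α⟩ _ hne
    rw [if_neg, mul_zero]
    rintro ⟨rfl, rfl⟩
    exact hne rfl
  · intro h
    rw [Set.Finite.mem_toFinset, Function.notMem_support] at h
    rw [h, zero_mul]

namespace FeynmanDiagram

/-- The divergence condition on a subgraph only depends on its forest of pieces. -/
lemma extractable_iff_divergent (ℓ : ℝ) (d : ℕ) (G : FeynmanDiagram) (S : Set G.E) :
    G.Extractable ℓ d S ↔
      G.Contractible S ∧ MIForest.Divergent ℓ d ((G.pieceForest S).map FD.toMI) := by
  have h1 : S.Nonempty ↔ (G.pieceForest S).map FD.toMI ≠ 0 := by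
    rw [pieceForest, forestOf, ne_eq, Multiset.map_eq_zero, Multiset.map_eq_zero,
      Finset.val_eq_zero, Finset.univ_eq_empty_iff, not_isEmpty_iff]
    exact ⟨fun ⟨e, he⟩ => ⟨pieceOf e he⟩, fun ⟨c⟩ => ⟨_, c.2.choose_spec.1⟩⟩
  have h2 : (∀ c : G.Piece S, (G.extract S c).deg ℓ d ≤ 0) ↔
      ∀ β ∈ (G.pieceForest S).map FD.toMI, MI.deg ℓ d β ≤ 0 := by
    simp [pieceForest, forestOf, deg_toMI]
  rw [Extractable, MIForest.Divergent, h1, h2]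
  tauto

open Classical in
lemma tensorCoeff_coproduct (ℓ : ℝ) (d : ℕ) (G : FeynmanDiagram) (F : FDForest) (Q : FD) :
    tensorCoeff F Q (G.coproduct ℓ d) =
      if MIForest.Divergent ℓ d (F.map FD.toMI) then
        (Nat.card {S : {S : Set G.E // G.Contractible S} //
          G.pieceForest S.1 = F ∧ (G.contract S.1 S.2).toFD = Q} : ℝ) else 0 := by
  have h1 : tensorCoeff F Q (G.coproduct ℓ d) =
      (Nat.card {S : {S : Set G.E // G.Extractable ℓ d S} //
        G.pieceForest S.1 = F ∧ (G.contract S.1 S.2.2.1).toFD = Q} : ℝ) := by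
    rw [coproduct, finsum_eq_sum_of_fintype, map_sum, Nat.card_eq_fintype_card,
      Fintype.card_subtype, ← Finset.sum_boole]
    refine Finset.sum_congr rfl fun S _ => ?_
    change tensorCoeff F Q (Finsupp.single (G.pieceForest S.1) 1 ⊗ₜ[ℝ]
      Finsupp.single (G.contract S.1 S.2.2.1).toFD 1) = _
    rw [tensorCoeff_tmul, Finsupp.single_apply, Finsupp.single_apply, ite_zero_mul_ite_zero,
      mul_one]
  rw [h1]
  split_ifs with h
  · refine congrArg Nat.cast (Nat.card_congr ?_)
    exact
      { toFun S := ⟨⟨S.1.1, S.1.2.2.1⟩, S.2⟩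
        invFun S := ⟨⟨S.1.1, (extractable_iff_divergent ℓ d G _).2
          ⟨S.1.2, by rw [S.2.1]; exact h⟩⟩, S.2⟩
        left_inv S := rfl
        right_inv S := rfl }
  · have : IsEmpty {S : {S : Set G.E // G.Extractable ℓ d S} //
        G.pieceForest S.1 = F ∧ (G.contract S.1 S.2.2.1).toFD = Q} :=
      ⟨fun S => h (by rw [← S.2.1]; exact ((extractable_iff_divergent ℓ d G _).1 S.1.2).2)⟩
    rw [Nat.card_of_isEmpty, Nat.cast_zero]

end FeynmanDiagram

/-- The coefficients of `Δ_F` on an isomorphism class of diagrams, through the number of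
insertions that produce it. -/
lemma tensorCoeff_coproductF {I : Type} [Fintype I] (ℓ : ℝ) (d : ℕ) (K : I → FeynmanDiagram)
    (Q : FeynmanDiagram) {F : FDForest} (hK : FeynmanDiagram.forestOf K = F)
    (h : MIForest.Divergent ℓ d (F.map FD.toMI)) (G : FD) (c : ℝ) :
    tensorCoeff F Q.toFD (coproductF ℓ d (Finsupp.single G (c / G.sym))) =
      c * Nat.card {z : FeynmanDiagram.Insertion K Q // z.graft.toFD = G} /
        (forestSym FD.sym F * Q.toFD.sym) := by
  induction G using Quotient.inductionOn with
  | h G =>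
  have h1 : coproductF ℓ d (Finsupp.single G.toFD (c / G.sym)) = (c / G.sym) • G.coproduct ℓ d := by
    rw [coproductF, Finsupp.linearCombination_single]
    rfl
  have h2 := congrArg (Nat.cast (R := ℝ)) (FeynmanDiagram.card_graft_mul_sym_eq K Q G)
  rw [hK] at h2
  push_cast at h2
  have h3 : (forestSym FD.sym F : ℝ) ≠ 0 :=
    Nat.cast_ne_zero.2 (forestSym_pos FD.sym_pos _).ne'
  have h4 : (Q.sym : ℝ) ≠ 0 := Nat.cast_ne_zero.2 Q.sym_pos.ne'
  have h5 : (G.sym : ℝ) ≠ 0 := Nat.cast_ne_zero.2 G.sym_pos.ne'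
  change tensorCoeff _ _ (coproductF ℓ d (Finsupp.single G.toFD (c / G.sym))) =
    c * Nat.card {z : FeynmanDiagram.Insertion K Q // z.graft.toFD = G.toFD} / (_ * Q.sym)
  simp only [FeynmanDiagram.toFD_eq_iff]
  rw [h1, map_smul, FeynmanDiagram.tensorCoeff_coproduct, if_pos h, smul_eq_mul]
  field_simp
  linear_combination -c * h2

end

theorem theorem4p4 (ℓ : ℝ) (d : ℕ) (β : MI) :
    TensorProduct.map liftForestP liftP (coproductM ℓ d (Finsupp.single β 1)) =
      coproductF ℓ d (liftP (Finsupp.single β 1)) := by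
  classical
  refine ext_tensorCoeff fun F Q => ?_
  induction Q using Quotient.inductionOn with
  | h Q =>
  change tensorCoeff F Q.toFD _ = tensorCoeff F Q.toFD _
  rw [tensorCoeff_lift_coproductM, liftP, Finsupp.linearCombination_single, one_smul, map_sum,
    map_sum]
  split_ifs with h
  · obtain ⟨K, hK, hl⟩ := exists_forestOf_eq F
    rw [pairing, insertion, FeynmanDiagram.coeff_insertionList _ K Q hl]
    have hR : ∀ G : FD, tensorCoeff F Q.toFD (coproductF ℓ d (Finsupp.single G (β.sym / G.sym))) =
        β.sym * Nat.card {z : FeynmanDiagram.Insertion K Q // z.graft.toFD = G} /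
          (forestSym FD.sym F * Q.toFD.sym) :=
      fun G => tensorCoeff_coproductF ℓ d K Q hK h G _
    rw [Finset.sum_congr rfl fun G _ => hR G, ← Finset.sum_div, ← Finset.mul_sum, ← Nat.cast_sum]
    have := Fintype.ofFinite (FeynmanDiagram.Insertion K Q)
    congr 3
    -- Sort the insertions with result counted by `β` according to the class of the result.
    simp only [Nat.card_eq_fintype_card, Fintype.card_subtype]
    rw [Finset.card_eq_sum_card_fiberwise (f := fun z => z.graft.toFD)
      (t := (FD.finite_fiber β.1).toFinset)]
    · refine Finset.sum_congr rfl fun G hG => ?_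
      rw [Finset.filter_filter]
      congr 1
      refine Finset.filter_congr fun z _ => ⟨fun h => h.2, fun h => ⟨?_, h⟩⟩
      rw [Set.Finite.mem_toFinset] at hG
      rw [← FeynmanDiagram.toFD_count, h]
      exact hG
    · intro z hz
      simpa using hz
  · refine (Finset.sum_eq_zero fun G _ => ?_).symm
    rw [coproductF, Finsupp.linearCombination_single, map_smul]
    induction G using Quotient.inductionOn with
    | h G =>
    refine (congrArg _ (FeynmanDiagram.tensorCoeff_coproduct ℓ d G F Q.toFD)).trans ?_
    rw [if_neg h, smul_zero]
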